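/- **Setting.** Let $D\subset\mathbb R^2$ be a simply connected domain carrying a planar $4$-web, i.e. four smooth ($C^\infty$) $1$-forms $\theta_1,\dots,\theta_4$ on $D$, any two of which are linearly independent at every point. The *rank* of the web is the dimension of the real vector space of quadruples $(\lambda_1,\dots,\lambda_4)$ of smooth functions on $D$ with $\sum_i\lambda_i\theta_i=0$ and $d(\lambda_i\theta_i)=0$ for all $i$ (the abelian equation). Normalize the web: let $\omega_i$ be smooth nowhere vanishing multiples of $\theta_i$ with $$\omega_1+\omega_2+\omega_3=0,\qquad a\,\omega_1+\omega_2+\omega_4=0,$$ where the function $a$ (the basic invariant) satisfies $a\neq 0,1$. There is a unique $1$-form $\gamma=g_1\omega_1+g_2\omega_2$ with $d\omega_i=\omega_i\wedge\gamma$ for $i=1,2,3$; let $K$ be defined by $d\gamma=K\,\omega_1\wedge\omega_2$. Let $(\partial_1,\partial_2)$ be the frame dual to $(\omega_1,\omega_2)$. For a function $u$ of weight $w$ put $\delta_i u=\partial_i(u)-w\,g_i\,u$, a function of weight $w+1$. Here $a$ has weight $0$, $K$ and $c_0$ have weight $2$, and $c_1,c_2$ have weight $3$. Put $a_i=\delta_i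 a$, $a_{ij}=\delta_i\delta_j a$ (symmetric in $i,j$), $K_i=\delta_iK$, $c_{k,i}=\delta_i c_k$, and let $a_{112},a_{122}$ be the symmetrized third derivatives $$a_{112}=\tfrac13(\delta_1\delta_1\delta_2+\delta_1\delta_2\delta_1+\delta_2\delta_1\delta_1)a,\qquad a_{122}=\tfrac13(\delta_1\delta_2\delta_2+\delta_2\delta_1\delta_2+\delta_2\delta_2\delta_1)a .$$ Define $$\begin{aligned} c_0&=K+\frac{a_{11}-aa_{22}-2(1-a)a_{12}}{4a(1-a)}+\frac{(2a-1)a_1^2-a^2a_2^2+2(1-a)^2a_1a_2}{4(1-a)^2a^2},\\ c_1&=\frac{K_2-K_1}{4(1-a)}+\frac{(a-4)a_1+(11-20a+12a^2)a_2}{12(1-a)^2a}K+\frac{a_{112}-a_{122}}{4a(1-a)}+\frac{a_1-aa_2}{4a^2(1-a)}a_{22}\\ &\quad+\frac{(2a-1)(a_1-aa_2)}{4(1-a)^2a^2}a_{12}-\frac{a_2^2\big((1-2a)a_1+aa_2\big)}{4(1-a)^2a^2},\\ c_2&=\frac{aK_2-K_1}{4a(1-a)}+\frac{(1-2a)a_1-(a-2)aa_2}{4(1-a)^2a^2}K,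 \end{aligned}$$ and $$\begin{aligned} G_{11}&=ac_0(c_{2,2}-c_{2,1})+ac_2(c_{0,1}-c_{0,2})-a(1-a)c_1c_2+(2a_2-a_1-aa_2)c_0c_2-Kc_0^2,\\ G_{12}&=ac_0(c_{1,2}-c_{1,1})+ac_1(c_{0,1}-c_{0,2})-a(1-a)c_1^2+(2a_2-a_1-2aa_2)c_0c_1+(a_2^2+a_{12}-a_{22})c_0^2,\\ G_{21}&=c_0(c_{2,1}-ac_{2,2})+c_2(ac_{0,2}-c_{0,1})-2a_2c_0c_2+a(1-a)c_2^2,\\ G_{22}&=c_0(c_{1,1}-ac_{1,2})+c_1(ac_{0,2}-c_{0,1})+a(1-a)c_1c_2-a_2c_0c_1-a_2(1-a)c_0c_2+(a_{22}-K)c_0^2 . \end{aligned}$$ **Theorem.** (i) If the web has rank two, then $c_0$ is not identically zero on $D$, and $G_{11}=G_{12}=G_{21}=G_{22}=0$ on $D$. (ii) Suppose that $c_0$ either vanishes identically on $D$ or vanishes nowhere on $D$. Then the web has rank two if and only if $c_0\neq 0$ and $G_{11}=G_{12}=G_{21}=G_{22}=0$ on $D$. -/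

import Mathlib

open scoped ContDiff

noncomputable section

namespace PlanarWebs

/-- Differential `1`-forms on the plane (only their values on the domain of a web matter). -/
abbrev OneForm : Type := ℝ × ℝ → (ℝ × ℝ →L[ℝ] ℝ)

/-- The coefficient of `dx ∧ dy` in `α ∧ β`. -/
def wedge (α β : OneForm) (p : ℝ × ℝ) : ℝ :=
  α p (1, 0) * β p (0, 1) - α p (0, 1) * β p (1, 0)

/-- The coefficient of `dx ∧ dy` in `dα`: for `α = P dx + Q dy` it is `∂Q/∂x - ∂P/∂y`. -/
def extD (α : OneForm) (p : ℝ × ℝ) : ℝ :=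
  fderiv ℝ α p (1, 0) (0, 1) - fderiv ℝ α p (0, 1) (1, 0)

/-- A planar `d`-web on an open set: `d` smooth `1`-forms, any two of which are linearly
independent at every point. The leaves of the `i`-th foliation are the integral curves of
`form i = 0`. -/
structure PlanarWeb (d : ℕ) where
  domain : TopologicalSpace.Opens (ℝ × ℝ)
  form : Fin d → OneForm
  smooth : ∀ i, ContDiffOn ℝ ∞ (form i) domain
  transversal : ∀ i j, i ≠ j → ∀ p ∈ domain, wedge (form i) (form j) p ≠ 0

theorem extD_add {α β : OneForm} {p : ℝ × ℝ} (hα : DifferentiableAt ℝ α p)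
    (hβ : DifferentiableAt ℝ β p) : extD (α + β) p = extD α p + extD β p := by
  simp only [extD, fderiv_add hα hβ, add_apply]
  ring

theorem extD_const_smul {α : OneForm} {p : ℝ × ℝ} (c : ℝ) (hα : DifferentiableAt ℝ α p) :
    extD (c • α) p = c * extD α p := by
  simp only [extD, fderiv_const_smul hα, smul_apply, smul_eq_mul]
  ring

theorem PlanarWeb.differentiableAt_smul {d : ℕ} (W : PlanarWeb d) {f : ℝ × ℝ → ℝ}
    (hf : ContDiffOn ℝ ∞ f W.domain) (i : Fin d) {p : ℝ × ℝ} (hp : p ∈ W.domain) :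
    DifferentiableAt ℝ (fun q => f q • W.form i q) p :=
  ((hf.smul (W.smooth i)).contDiffAt (W.domain.isOpen.mem_nhds hp)).differentiableAt
    (by simp)

/-- The solution space of the abelian equation of a web: the `d`-tuples `(l 0, …, l (d-1))` of
smooth functions on the domain with `∑ i, l i • ω i = 0` and all `l i • ω i` closed. A function
on the domain is represented by its extension by zero. -/
def PlanarWeb.abelianSolutions {d : ℕ} (W : PlanarWeb d) :
    Submodule ℝ (ℝ × ℝ → Fin d → ℝ) where
  carrier := {l | (∀ i, ContDiffOn ℝ ∞ (fun p => l p i) W.domain) ∧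
    (∀ p ∉ W.domain, l p = 0) ∧
    (∀ p ∈ W.domain, ∑ i, l p i • W.form i p = 0) ∧
    (∀ i, ∀ p ∈ W.domain, extD (fun q => l q i • W.form i q) p = 0)}
  add_mem' := by
    rintro l m ⟨hl1, hl2, hl3, hl4⟩ ⟨hm1, hm2, hm3, hm4⟩
    refine ⟨fun i => (hl1 i).add (hm1 i), fun p hp => ?_, fun p hp => ?_, fun i p hp => ?_⟩
    · simp [hl2 p hp, hm2 p hp]
    · simp only [Pi.add_apply, add_smul, Finset.sum_add_distrib, hl3 p hp, hm3 p hp, add_zero]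
    · have h := extD_add (W.differentiableAt_smul (hl1 i) i hp)
        (W.differentiableAt_smul (hm1 i) i hp)
      rw [hl4 i p hp, hm4 i p hp, add_zero] at h
      rw [← h]
      congr 1
      funext q
      simp [add_smul]
  zero_mem' := by
    refine ⟨fun i => by simpa using contDiffOn_const, fun p _ => rfl, fun p _ => by simp,
      fun i p _ => ?_⟩
    simp [extD]
  smul_mem' := by
    rintro c l ⟨hl1, hl2, hl3, hl4⟩
    refine ⟨fun i => (hl1 i).const_smul c, fun p hp => ?_, fun p hp => ?_,
      fun i p hp => ?_⟩
    · simp [hl2 p hp]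
    · simp only [Pi.smul_apply, smul_eq_mul, mul_smul, ← Finset.smul_sum, hl3 p hp, smul_zero]
    · have h := extD_const_smul c (W.differentiableAt_smul (hl1 i) i hp)
      rw [hl4 i p hp, mul_zero] at h
      rw [← h]
      congr 1
      funext q
      simp [mul_smul]

/-- The rank of a web is the dimension of the solution space of its abelian equation. -/
def PlanarWeb.rank {d : ℕ} (W : PlanarWeb d) : Cardinal := Module.rank ℝ W.abelianSolutions

/-- A normalization of a planar `4`-web: `1`-forms `ω₁, ω₂, ω₃, ω₄` defining the same four
foliations, with `ω₁ + ω₂ + ω₃ = 0` and `a ω₁ + ω₂ + ω₄ = 0`. The function `a` is the basic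
invariant. -/
structure Normalization (W : PlanarWeb 4) where
  ω₁ : OneForm
  ω₂ : OneForm
  ω₃ : OneForm
  ω₄ : OneForm
  a : ℝ × ℝ → ℝ
  smooth₁ : ContDiffOn ℝ ∞ ω₁ W.domain
  smooth₂ : ContDiffOn ℝ ∞ ω₂ W.domain
  smooth₃ : ContDiffOn ℝ ∞ ω₃ W.domain
  smooth₄ : ContDiffOn ℝ ∞ ω₄ W.domain
  scale₁ : ∀ p ∈ W.domain, ∃ s : ℝ, s ≠ 0 ∧ ω₁ p = s • W.form 0 p
  scale₂ : ∀ p ∈ W.domain, ∃ s : ℝ, s ≠ 0 ∧ ω₂ p = s • W.form 1 p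
  scale₃ : ∀ p ∈ W.domain, ∃ s : ℝ, s ≠ 0 ∧ ω₃ p = s • W.form 2 p
  scale₄ : ∀ p ∈ W.domain, ∃ s : ℝ, s ≠ 0 ∧ ω₄ p = s • W.form 3 p
  rel₃ : ∀ p ∈ W.domain, ω₁ p + ω₂ p + ω₃ p = 0
  rel₄ : ∀ p ∈ W.domain, a p • ω₁ p + ω₂ p + ω₄ p = 0

namespace Normalization

variable {W : PlanarWeb 4} (N : Normalization W)

/-- The vector field `∂₁` of the frame dual to `ω₁, ω₂`. -/
def frame₁ (p : ℝ × ℝ) : ℝ × ℝ :=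
  (wedge N.ω₁ N.ω₂ p)⁻¹ • (N.ω₂ p (0, 1), -N.ω₂ p (1, 0))

/-- The vector field `∂₂` of the frame dual to `ω₁, ω₂`. -/
def frame₂ (p : ℝ × ℝ) : ℝ × ℝ :=
  (wedge N.ω₁ N.ω₂ p)⁻¹ • (-N.ω₁ p (0, 1), N.ω₁ p (1, 0))

/-- The coefficient `g₁` of the connection form `γ = g₁ ω₁ + g₂ ω₂`. -/
def g₁ (p : ℝ × ℝ) : ℝ := -(extD N.ω₂ p / wedge N.ω₁ N.ω₂ p)

/-- The coefficient `g₂` of the connection form `γ = g₁ ω₁ + g₂ ω₂`. -/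
def g₂ (p : ℝ × ℝ) : ℝ := extD N.ω₁ p / wedge N.ω₁ N.ω₂ p

/-- The form `γ` of the Chern connection, the unique `1`-form such that `dωᵢ = ωᵢ ∧ γ` for
`i = 1, 2, 3` (see `structure_equations` and `eq_γ_of_structure_equations`). -/
def γ : OneForm := fun p => N.g₁ p • N.ω₁ p + N.g₂ p • N.ω₂ p

/-- The curvature function of the `3`-web `⟨ω₁, ω₂, ω₃⟩`, that is, `dγ = K ω₁ ∧ ω₂`. -/
def K (p : ℝ × ℝ) : ℝ := extD N.γ p / wedge N.ω₁ N.ω₂ p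

/-- The covariant derivative `∂₁ u - w g₁ u` of a function `u` of weight `w`; it has weight
`w + 1`. -/
def δ₁ (w : ℕ) (u : ℝ × ℝ → ℝ) (p : ℝ × ℝ) : ℝ :=
  fderiv ℝ u p (N.frame₁ p) - w * N.g₁ p * u p

/-- The covariant derivative `∂₂ u - w g₂ u` of a function `u` of weight `w`; it has weight
`w + 1`. -/
def δ₂ (w : ℕ) (u : ℝ × ℝ → ℝ) (p : ℝ × ℝ) : ℝ :=
  fderiv ℝ u p (N.frame₂ p) - w * N.g₂ p * u p

/-! Covariant derivatives of the basic invariant (of weight `0`) and of `K` (of weight `2`).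
The second derivatives of `a` commute; the third ones are symmetrized. -/

def a₁ : ℝ × ℝ → ℝ := N.δ₁ 0 N.a

def a₂ : ℝ × ℝ → ℝ := N.δ₂ 0 N.a

def a₁₁ : ℝ × ℝ → ℝ := N.δ₁ 1 N.a₁

def a₁₂ : ℝ × ℝ → ℝ := N.δ₁ 1 N.a₂

def a₂₂ : ℝ × ℝ → ℝ := N.δ₂ 1 N.a₂

def a₁₁₂ (p : ℝ × ℝ) : ℝ :=
  (N.δ₁ 2 (N.δ₁ 1 N.a₂) p + N.δ₁ 2 (N.δ₂ 1 N.a₁) p + N.δ₂ 2 (N.δ₁ 1 N.a₁) p) / 3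

def a₁₂₂ (p : ℝ × ℝ) : ℝ :=
  (N.δ₁ 2 (N.δ₂ 1 N.a₂) p + N.δ₂ 2 (N.δ₁ 1 N.a₂) p + N.δ₂ 2 (N.δ₂ 1 N.a₁) p) / 3

def K₁ : ℝ × ℝ → ℝ := N.δ₁ 2 N.K

def K₂ : ℝ × ℝ → ℝ := N.δ₂ 2 N.K

/-! The coefficients of the obstruction `c₀ v₂ + c₁ v + c₂ u`, of weights `2`, `3`, `3`. -/

def c₀ (p : ℝ × ℝ) : ℝ :=
  let a := N.a p; let a₁ := N.a₁ p; let a₂ := N.a₂ p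
  let a₁₁ := N.a₁₁ p; let a₁₂ := N.a₁₂ p; let a₂₂ := N.a₂₂ p
  N.K p + (a₁₁ - a * a₂₂ - 2 * (1 - a) * a₁₂) / (4 * a * (1 - a))
    + ((-1 + 2 * a) * a₁ ^ 2 - a ^ 2 * a₂ ^ 2 + 2 * (1 - a) ^ 2 * a₁ * a₂)
      / (4 * (1 - a) ^ 2 * a ^ 2)

def c₁ (p : ℝ × ℝ) : ℝ :=
  let a := N.a p; let a₁ := N.a₁ p; let a₂ := N.a₂ p
  let a₁₂ := N.a₁₂ p; let a₂₂ := N.a₂₂ p; let a₁₁₂ := N.a₁₁₂ p; let a₁₂₂ := N.a₁₂₂ p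
  let K := N.K p; let K₁ := N.K₁ p; let K₂ := N.K₂ p
  (K₂ - K₁) / (4 * (1 - a))
    + ((a - 4) * a₁ + (11 - 20 * a + 12 * a ^ 2) * a₂) / (12 * (1 - a) ^ 2 * a) * K
    + (a₁₁₂ - a₁₂₂) / (4 * a * (1 - a))
    + (a₁ - a * a₂) / (4 * a ^ 2 * (1 - a)) * a₂₂
    + ((2 * a - 1) * (a₁ - a * a₂)) / (4 * (1 - a) ^ 2 * a ^ 2) * a₁₂
    - (a₂ ^ 2 * ((1 - 2 * a) * a₁ + a * a₂)) / (4 * (1 - a) ^ 2 * a ^ 2)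

def c₂ (p : ℝ × ℝ) : ℝ :=
  let a := N.a p; let a₁ := N.a₁ p; let a₂ := N.a₂ p
  let K := N.K p; let K₁ := N.K₁ p; let K₂ := N.K₂ p
  (a * K₂ - K₁) / (4 * a * (1 - a))
    + ((1 - 2 * a) * a₁ - (a - 2) * a * a₂) / (4 * (1 - a) ^ 2 * a ^ 2) * K

/-! Covariant derivatives: `cᵢⱼ` is `δⱼ cᵢ`. -/

def c₀₁ : ℝ × ℝ → ℝ := N.δ₁ 2 N.c₀

def c₀₂ : ℝ × ℝ → ℝ := N.δ₂ 2 N.c₀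

def c₁₁ : ℝ × ℝ → ℝ := N.δ₁ 3 N.c₁

def c₁₂ : ℝ × ℝ → ℝ := N.δ₂ 3 N.c₁

def c₂₁ : ℝ × ℝ → ℝ := N.δ₁ 3 N.c₂

def c₂₂ : ℝ × ℝ → ℝ := N.δ₂ 3 N.c₂

def G₁₁ (p : ℝ × ℝ) : ℝ :=
  let a := N.a p; let a₁ := N.a₁ p; let a₂ := N.a₂ p
  let c₀ := N.c₀ p; let c₁ := N.c₁ p; let c₂ := N.c₂ p
  a * c₀ * (N.c₂₂ p - N.c₂₁ p) + a * c₂ * (N.c₀₁ p - N.c₀₂ p) - a * (1 - a) * c₁ * c₂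
    + (2 * a₂ - a₁ - a * a₂) * c₀ * c₂ - N.K p * c₀ ^ 2

def G₁₂ (p : ℝ × ℝ) : ℝ :=
  let a := N.a p; let a₁ := N.a₁ p; let a₂ := N.a₂ p
  let c₀ := N.c₀ p; let c₁ := N.c₁ p
  a * c₀ * (N.c₁₂ p - N.c₁₁ p) + a * c₁ * (N.c₀₁ p - N.c₀₂ p) - a * (1 - a) * c₁ ^ 2
    + (2 * a₂ - a₁ - 2 * a * a₂) * c₀ * c₁ + (a₂ ^ 2 + N.a₁₂ p - N.a₂₂ p) * c₀ ^ 2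

def G₂₁ (p : ℝ × ℝ) : ℝ :=
  let a := N.a p; let a₂ := N.a₂ p
  let c₀ := N.c₀ p; let c₂ := N.c₂ p
  c₀ * (N.c₂₁ p - a * N.c₂₂ p) + c₂ * (a * N.c₀₂ p - N.c₀₁ p) - 2 * a₂ * c₀ * c₂
    + a * (1 - a) * c₂ ^ 2

def G₂₂ (p : ℝ × ℝ) : ℝ :=
  let a := N.a p; let a₂ := N.a₂ p
  let c₀ := N.c₀ p; let c₁ := N.c₁ p; let c₂ := N.c₂ p
  c₀ * (N.c₁₁ p - a * N.c₁₂ p) + c₁ * (a * N.c₀₂ p - N.c₀₁ p) + a * (1 - a) * c₁ * c₂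
    - a₂ * c₀ * c₁ - a₂ * (1 - a) * c₀ * c₂ + (N.a₂₂ p - N.K p) * c₀ ^ 2

/-! The frame is dual to `ω₁, ω₂`, and `γ` is the unique solution of the structure equations. -/

theorem wedge_ne_zero {p : ℝ × ℝ} (hp : p ∈ W.domain) : wedge N.ω₁ N.ω₂ p ≠ 0 := by
  obtain ⟨s, hs, h1⟩ := N.scale₁ p hp
  obtain ⟨t, ht, h2⟩ := N.scale₂ p hp
  have h := W.transversal 0 1 (by decide) p hp
  have : wedge N.ω₁ N.ω₂ p = s * t * wedge (W.form 0) (W.form 1) p := by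
    simp only [wedge, h1, h2, smul_apply, smul_eq_mul]
    ring
  rw [this]
  exact mul_ne_zero (mul_ne_zero hs ht) h

theorem dual_frame {p : ℝ × ℝ} (hp : p ∈ W.domain) :
    N.ω₁ p (N.frame₁ p) = 1 ∧ N.ω₂ p (N.frame₁ p) = 0 ∧
    N.ω₁ p (N.frame₂ p) = 0 ∧ N.ω₂ p (N.frame₂ p) = 1 := by
  have h := N.wedge_ne_zero hp
  have key : ∀ (α : ℝ × ℝ →L[ℝ] ℝ) (x y : ℝ), α (x, y) = x * α (1, 0) + y * α (0, 1) := by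
    intro α x y
    have : ((x, y) : ℝ × ℝ) = x • ((1, 0) : ℝ × ℝ) + y • ((0, 1) : ℝ × ℝ) := by simp
    rw [this, map_add, map_smul, map_smul, smul_eq_mul, smul_eq_mul]
  simp only [frame₁, frame₂, map_smul, smul_eq_mul]
  simp only [key (N.ω₁ p) (N.ω₂ p (0, 1)), key (N.ω₂ p) (N.ω₂ p (0, 1)),
    key (N.ω₁ p) (-N.ω₁ p (0, 1)), key (N.ω₂ p) (-N.ω₁ p (0, 1))]
  refine ⟨?_, ?_, ?_, ?_⟩
  · field_simp
    simp only [wedge]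
    ring
  · ring
  · ring
  · field_simp
    simp only [wedge]
    ring

theorem structure_equations {p : ℝ × ℝ} (hp : p ∈ W.domain) :
    extD N.ω₁ p = wedge N.ω₁ N.γ p ∧ extD N.ω₂ p = wedge N.ω₂ N.γ p ∧
    extD N.ω₃ p = wedge N.ω₃ N.γ p := by
  have h := N.wedge_ne_zero hp
  have e1 : extD N.ω₁ p = wedge N.ω₁ N.γ p := by
    have : wedge N.ω₁ N.γ p = N.g₂ p * wedge N.ω₁ N.ω₂ p := by
      simp [wedge, γ]
      ring
    rw [this, g₂, div_mul_cancel₀ _ h]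
  have e2 : extD N.ω₂ p = wedge N.ω₂ N.γ p := by
    have : wedge N.ω₂ N.γ p = -N.g₁ p * wedge N.ω₁ N.ω₂ p := by
      simp [wedge, γ]
      ring
    rw [this, g₁, neg_neg, div_mul_cancel₀ _ h]
  have hn := W.domain.isOpen.mem_nhds hp
  have d1 : DifferentiableAt ℝ N.ω₁ p := (N.smooth₁.contDiffAt hn).differentiableAt (by simp)
  have d2 : DifferentiableAt ℝ N.ω₂ p := (N.smooth₂.contDiffAt hn).differentiableAt (by simp)
  have heq : N.ω₃ =ᶠ[nhds p] (-1 : ℝ) • (N.ω₁ + N.ω₂) := by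
    filter_upwards [hn] with q hq
    have h3 := N.rel₃ q hq
    exact (neg_eq_of_add_eq_zero_right h3).symm.trans (neg_one_smul ℝ _).symm
  refine ⟨e1, e2, ?_⟩
  have : extD N.ω₃ p = extD ((-1 : ℝ) • (N.ω₁ + N.ω₂)) p := by
    simp only [extD, heq.fderiv_eq]
  rw [this, extD_const_smul _ (d1.add d2), extD_add d1 d2, e1, e2]
  have hp3 := heq.self_of_nhds
  simp only [wedge, hp3, Pi.smul_apply, Pi.add_apply, smul_apply,
    add_apply, smul_eq_mul]
  ring

theorem eq_γ_of_structure_equations {p : ℝ × ℝ} (hp : p ∈ W.domain) (η : OneForm)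
    (h1 : extD N.ω₁ p = wedge N.ω₁ η p) (h2 : extD N.ω₂ p = wedge N.ω₂ η p) :
    η p = N.γ p := by
  have h := N.wedge_ne_zero hp
  obtain ⟨e1, e2, -⟩ := N.structure_equations hp
  rw [e1] at h1
  rw [e2] at h2
  simp only [wedge] at h h1 h2
  have hx : η p (1, 0) = N.γ p (1, 0) := by
    have : (N.ω₁ p (1, 0) * N.ω₂ p (0, 1) - N.ω₁ p (0, 1) * N.ω₂ p (1, 0)) *
        (η p (1, 0) - N.γ p (1, 0)) = 0 := by
      linear_combination (N.ω₁ p (1, 0)) * h2 - (N.ω₂ p (1, 0)) * h1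
    exact sub_eq_zero.mp ((mul_eq_zero.mp this).resolve_left h)
  have hy : η p (0, 1) = N.γ p (0, 1) := by
    have : (N.ω₁ p (1, 0) * N.ω₂ p (0, 1) - N.ω₁ p (0, 1) * N.ω₂ p (1, 0)) *
        (η p (0, 1) - N.γ p (0, 1)) = 0 := by
      linear_combination (N.ω₁ p (0, 1)) * h2 - (N.ω₂ p (0, 1)) * h1
    exact sub_eq_zero.mp ((mul_eq_zero.mp this).resolve_left h)
  ext
  · simpa using hx
  · simpa using hy

end Normalization

end PlanarWebs

end

/-! After rescaling, an abelian relation is a quadruple of multipliers of the normalized forms `ω₁,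
ω₂, ω₃, ω₄`. The linear relation between these forms leaves two unknowns of weight 1: the
multipliers `u` of `ω₃` and `v` of `ω₄`, those of `ω₁, ω₂` being `u + a v` and `u + v`. Closedness
becomes `δ₁ u = δ₂ u = -δ₁ v` and `δ₁ v = a s + a₂ v`, where `s = δ₂ v`. Since `δ₁ δ₂ - δ₂ δ₁ = -w
K` on weight `w`, the integrability conditions for `u` and `v` are two linear equations for `δ₁ s,
δ₂ s`, uniquely solvable because `a ≠ 0, 1` (`compat_iff`). So `(u, v, s)` solves a closed linear
system and is determined by its value at one point. The integrability condition left over, that of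
`s`, is the obstruction `c₀ s + c₁ v + c₂ u = 0` (`ProlongedAt.compat`). Differentiating it gives
two more linear equations.

If the rank is two, then at each point these three equations on a three-dimensional space have a
two-dimensional solution space, so the 2 × 2 minors of their coefficients vanish; the `Gᵢⱼ` are
invertible combinations of the four minors that pair the obstruction with a derivative of it and use
the column of `s` (`G_eq_zero_iff`, `minors_eq_zero_of_rank_eq_two`). If `c₀` vanished identically,
the minors would force `c₁ = c₂ = 0`; the prolonged system would be integrable and have a
three-dimensional solution space, a contradiction.

Conversely, where `c₀ ≠ 0` the obstruction gives `s` in terms of `u` and `v`, and `Gᵢⱼ = 0` makes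
the reduced system for `(u, v)` integrable (`exists_reduced`). On a simply connected domain its
solutions have arbitrary initial values, so the rank is two.

The analytic input is the Frobenius theorem for linear systems `dX = A X`: local solutions by Picard
iteration along segments, and a global one as a section of the covering space of germs of solutions
(`exists_isSolutionOn`). -/

noncomputable section

namespace PlanarWebs

open Set Filter Topology MeasureTheory

/-! ### Radial integration of 1-forms that are only approximately closed. -/

section TotalDifferential

variable {V E : Type*} [NormedAddCommGroup V] [NormedSpace ℝ V] [ProperSpace V]
  [NormedAddCommGroup E] [NormedSpace ℝ E] [CompleteSpace E]

/-- The integral of a `1`-form along the segment from `q₀` to `q`. -/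
def radialIntegral (q₀ : V) (β : V → V →L[ℝ] E) (q : V) : E :=
  ∫ t in (0 : ℝ)..1, β (q₀ + t • (q - q₀)) (q - q₀)

omit [ProperSpace V] in
theorem segment_mem {s : Set V} (hs : Convex ℝ s) {q₀ q : V} (h₀ : q₀ ∈ s) (hq : q ∈ s) {t : ℝ}
    (ht : t ∈ Icc (0 : ℝ) 1) : q₀ + t • (q - q₀) ∈ s :=
  hs.add_smul_sub_mem h₀ hq ht

theorem intervalIntegrable_of_continuousOn_Icc {X : Type*} [NormedAddCommGroup X]
    {f : ℝ → X} (hf : ContinuousOn f (Icc (0 : ℝ) 1)) : IntervalIntegrable f volume 0 1 :=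
  ContinuousOn.intervalIntegrable (by rwa [uIcc_of_le zero_le_one])

/-- A Poincaré lemma with an error term: a primitive by radial integration fails by at most the size
of the exterior derivative. Picard iterates produce forms that are not closed, so the exact
statement would not suffice. -/
theorem hasFDerivAt_radialIntegral {s : Set V} (hs : Convex ℝ s) (ho : IsOpen s) {q₀ : V}
    (h₀ : q₀ ∈ s) {β : V → V →L[ℝ] E} (hβ : ContDiffOn ℝ 1 β s) {C : ℝ}
    (hC : ∀ q ∈ s, ∀ h k, ‖fderiv ℝ β q h k - fderiv ℝ β q k h‖ ≤ C * ‖h‖ * ‖k‖) (hC0 : 0 ≤ C)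
    : ContDiffOn ℝ 1 (radialIntegral q₀ β) s ∧ ∀ q ∈ s,
      ∃ R : V →L[ℝ] E, ‖R‖ ≤ C * ‖q - q₀‖ ∧ HasFDerivAt (radialIntegral q₀ β) (β q + R) q := by
  have hd : ∀ x ∈ s, HasFDerivAt β (fderiv ℝ β x) x := fun x hx =>
    ((hβ.contDiffAt (ho.mem_nhds hx)).differentiableAt (by simp)).hasFDerivAt
  have hcβ : ContinuousOn β s := hβ.continuousOn
  have hcd : ContinuousOn (fderiv ℝ β) s := hβ.continuousOn_fderiv_of_isOpen ho le_rfl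
  let γ : V × ℝ → V := fun z => q₀ + z.2 • (z.1 - q₀)
  have hγ : Continuous γ := by fun_prop
  have hmaps : MapsTo γ (s ×ˢ Icc (0 : ℝ) 1) s := fun z hz => segment_mem hs h₀ hz.1 hz.2
  -- The derivative of the integrand in `x`, to be integrated over `t`.
  let F' : V → ℝ → V →L[ℝ] E := fun x t =>
    β (γ (x, t)) + t • (fderiv ℝ β (γ (x, t))).flip (x - q₀)
  have hF'c : ContinuousOn (fun z : V × ℝ => F' z.1 z.2) (s ×ˢ Icc (0 : ℝ) 1) := by
    have h1 : ContinuousOn (fun z : V × ℝ => β (γ z)) (s ×ˢ Icc (0 : ℝ) 1) :=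
      hcβ.comp hγ.continuousOn hmaps
    have h2 : ContinuousOn (fun z : V × ℝ => fderiv ℝ β (γ z)) (s ×ˢ Icc (0 : ℝ) 1) :=
      hcd.comp hγ.continuousOn hmaps
    have h3 : ContinuousOn (fun z : V × ℝ => (fderiv ℝ β (γ z)).flip) (s ×ˢ Icc (0 : ℝ) 1) :=
      (ContinuousLinearMap.flipₗᵢ ℝ V V E).continuous.comp_continuousOn h2
    have h4 : ContinuousOn (fun z : V × ℝ => z.1 - q₀) (s ×ˢ Icc (0 : ℝ) 1) := by fun_prop
    exact h1.add (continuous_snd.continuousOn.smul (h3.clm_apply h4))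
  have hfix : ∀ x ∈ s, ∀ {X : Type _} [TopologicalSpace X] (f : V × ℝ → X),
      ContinuousOn f (s ×ˢ Icc (0 : ℝ) 1) → ContinuousOn (fun t => f (x, t)) (Icc (0 : ℝ) 1) := by
    intro x hx X _ f hf
    exact hf.comp (by fun_prop) fun t ht => ⟨hx, ht⟩
  have hIoc : uIoc (0 : ℝ) 1 ⊆ Icc 0 1 := by
    rw [uIoc_of_le zero_le_one]; exact Ioc_subset_Icc_self
  have hFc : ∀ x ∈ s, ContinuousOn (fun t : ℝ => β (γ (x, t)) (x - q₀)) (Icc (0 : ℝ) 1) := by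
    intro x hx
    exact (hfix x hx (fun z => β (γ z)) (hcβ.comp hγ.continuousOn hmaps)).clm_apply
      continuousOn_const
  have hcF' : ∀ q ∈ s, ContinuousOn (F' q) (Icc (0 : ℝ) 1) :=
    fun q hq => hfix q hq (fun z => F' z.1 z.2) hF'c
  have hbd : ∀ q ∈ s, ∃ u ∈ 𝓝 q, u ⊆ s ∧ ∃ M, ∀ x ∈ u ×ˢ Icc (0 : ℝ) 1, ‖F' x.1 x.2‖ ≤ M := by
    intro q hq
    obtain ⟨ε, hε, hball⟩ := Metric.isOpen_iff.mp ho q hq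
    have hcl : Metric.closedBall q (ε / 2) ⊆ s :=
      (Metric.closedBall_subset_ball (by linarith)).trans hball
    obtain ⟨M, hM⟩ := ((isCompact_closedBall q (ε / 2)).prod
      (isCompact_Icc (a := (0 : ℝ)) (b := 1))).exists_bound_of_continuousOn
        (hF'c.mono (prod_mono hcl Subset.rfl))
    exact ⟨_, Metric.closedBall_mem_nhds q (by linarith : 0 < ε / 2), hcl, M, hM⟩
  have key : ∀ q ∈ s, HasFDerivAt (radialIntegral q₀ β) (∫ t in (0 : ℝ)..1, F' q t) q := by
    intro q hq
    obtain ⟨u, hu, hcl, M, hM⟩ := hbd q hq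
    refine intervalIntegral.hasFDerivAt_integral_of_dominated_of_fderiv_le
      (F := fun x t => β (γ (x, t)) (x - q₀)) (bound := fun _ => M)
      hu ?_ ?_ ?_ ?_ ?_ ?_
    · filter_upwards [ho.mem_nhds hq] with x hx
      exact (intervalIntegrable_iff.mp (intervalIntegrable_of_continuousOn_Icc (hFc x hx))).1
    · exact intervalIntegrable_of_continuousOn_Icc (hFc q hq)
    · exact (intervalIntegrable_iff.mp (intervalIntegrable_of_continuousOn_Icc (hcF' q hq))).1
    · exact Eventually.of_forall fun t ht x hx => hM (x, t) ⟨hx, hIoc ht⟩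
    · exact intervalIntegrable_const
    · refine Eventually.of_forall fun t ht x hx => ?_
      have h1 : HasFDerivAt (fun x => γ (x, t)) (t • ContinuousLinearMap.id ℝ V) x :=
        (((hasFDerivAt_id x).sub_const q₀).const_smul t).const_add q₀
      have h2 := (hd _ (hmaps ⟨hcl hx, hIoc ht⟩ : γ (x, t) ∈ s)).comp x h1
      have h3 := h2.clm_apply ((hasFDerivAt_id x).sub_const q₀)
      refine h3.congr_fderiv ?_
      ext h
      simp [F']
  have keyc : ContinuousOn (fun q => ∫ t in (0 : ℝ)..1, F' q t) s := by
    intro q hq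
    obtain ⟨u, hu, hcl, M, hM⟩ := hbd q hq
    refine (intervalIntegral.continuousAt_of_dominated_interval (bound := fun _ => M)
      ?_ ?_ ?_ ?_).continuousWithinAt
    · filter_upwards [ho.mem_nhds hq] with x hx
      exact (intervalIntegrable_iff.mp
        (intervalIntegrable_of_continuousOn_Icc (hcF' x hx))).1
    · filter_upwards [hu] with x hx
      exact Eventually.of_forall fun t ht => hM (x, t) ⟨hx, hIoc ht⟩
    · exact intervalIntegrable_const
    · refine Eventually.of_forall fun t ht => ?_
      have : ContinuousOn (fun x => F' x t) s :=
        hF'c.comp (f := fun x => (x, t)) (by fun_prop) fun x hx => ⟨hx, hIoc ht⟩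
      exact this.continuousAt (ho.mem_nhds hq)
  constructor
  · rw [show (1 : WithTop ℕ∞) = 0 + 1 from rfl, contDiffOn_succ_iff_fderiv_of_isOpen ho]
    refine ⟨fun q hq => (key q hq).differentiableAt.differentiableWithinAt, by simp, ?_⟩
    rw [contDiffOn_zero]
    exact keyc.congr fun q hq => (key q hq).fderiv
  intro q hq
  let R : V →L[ℝ] E := ∫ t in (0 : ℝ)..1, t • ((fderiv ℝ β (γ (q, t))).flip (q - q₀)
    - fderiv ℝ β (γ (q, t)) (q - q₀))
  -- Exchanging the two arguments of `fderiv ℝ β` turns `F' q` into the `t`-derivative of `t • β (γ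
  -- (q, t))`, whose integral is `β q`; the cost of the exchange is `R`.
  let G' : ℝ → V →L[ℝ] E := fun t => β (γ (q, t)) + t • fderiv ℝ β (γ (q, t)) (q - q₀)
  have hcD : ContinuousOn (fun t : ℝ => fderiv ℝ β (γ (q, t))) (Icc (0 : ℝ) 1) :=
    hfix q hq (fun z => fderiv ℝ β (γ z)) (hcd.comp hγ.continuousOn hmaps)
  have hcB : ContinuousOn (fun t : ℝ => β (γ (q, t))) (Icc (0 : ℝ) 1) :=
    hfix q hq (fun z => β (γ z)) (hcβ.comp hγ.continuousOn hmaps)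
  have hcG' : ContinuousOn G' (Icc (0 : ℝ) 1) :=
    hcB.add (continuousOn_id.smul (hcD.clm_apply continuousOn_const))
  have hG : ∫ t in (0 : ℝ)..1, G' t = β q := by
    have := intervalIntegral.integral_eq_sub_of_hasDerivAt (a := 0) (b := 1)
      (f := fun t : ℝ => t • β (γ (q, t))) (f' := G') ?_ (intervalIntegrable_of_continuousOn_Icc hcG')
    · rw [this]; simp [γ]
    · intro t ht
      rw [uIcc_of_le zero_le_one] at ht
      have h1 : HasDerivAt (fun t : ℝ => γ (q, t)) (q - q₀) t := by
        simpa [γ] using ((hasDerivAt_id t).smul_const (q - q₀)).const_add q₀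
      have h2 := (hd _ (hmaps ⟨hq, ht⟩ : γ (q, t) ∈ s)).comp_hasDerivAt t h1
      have h3 := (hasDerivAt_id t).smul h2
      refine h3.congr_deriv ?_
      simp [G', add_comm]
  have hsum : ∫ t in (0 : ℝ)..1, F' q t = β q + R := by
    have h : ∀ t, F' q t = G' t + t • ((fderiv ℝ β (γ (q, t))).flip (q - q₀)
        - fderiv ℝ β (γ (q, t)) (q - q₀)) := by
      intro t; simp only [F', G', smul_sub]; abel
    have hfl : ContinuousOn (fun t : ℝ => (fderiv ℝ β (γ (q, t))).flip) (Icc (0 : ℝ) 1) :=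
      (ContinuousLinearMap.flipₗᵢ ℝ V V E).continuous.comp_continuousOn hcD
    simp only [h]
    rw [intervalIntegral.integral_add (intervalIntegrable_of_continuousOn_Icc hcG') (intervalIntegrable_of_continuousOn_Icc ?_), hG]
    exact continuousOn_id.smul
      ((hfl.clm_apply continuousOn_const).sub (hcD.clm_apply continuousOn_const))
  refine ⟨R, ?_, hsum ▸ key q hq⟩
  have := intervalIntegral.norm_integral_le_of_norm_le_const (a := 0) (b := 1)
    (C := C * ‖q - q₀‖) (f := fun t : ℝ => t • ((fderiv ℝ β (γ (q, t))).flip (q - q₀)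
    - fderiv ℝ β (γ (q, t)) (q - q₀))) ?_
  · simpa only [sub_zero, abs_one, mul_one] using this
  intro t ht
  have ht' := hIoc ht
  rw [norm_smul, Real.norm_of_nonneg ht'.1]
  have hb : ‖(fderiv ℝ β (γ (q, t))).flip (q - q₀) - fderiv ℝ β (γ (q, t)) (q - q₀)‖
      ≤ C * ‖q - q₀‖ := by
    refine ContinuousLinearMap.opNorm_le_bound _ (by positivity) fun h => ?_
    have := hC _ (hmaps ⟨hq, ht'⟩ : γ (q, t) ∈ s) h (q - q₀)
    simp only [sub_apply, ContinuousLinearMap.flip_apply]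
    linarith
  calc t * _ ≤ 1 * (C * ‖q - q₀‖) := by
        apply mul_le_mul ht'.2 hb (norm_nonneg _) zero_le_one
    _ = _ := one_mul _

end TotalDifferential

/-! ### Local solutions of integrable linear total differential equations. -/

section TotalDifferential

variable {V E : Type*} [NormedAddCommGroup V] [NormedSpace ℝ V] [ProperSpace V]
  [NormedAddCommGroup E] [NormedSpace ℝ E] [CompleteSpace E]

/-- `X` solves the linear total differential equation `dX = A X` on `s`. -/
def IsSolutionOn (A : V → E →L[ℝ] V →L[ℝ] E) (s : Set V) (X : V → E) : Prop :=
  ∀ q ∈ s, HasFDerivAt X (A q (X q)) q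

/-- The integrability condition of the total differential equation `dX = A X`. -/
def IsFlatOn (A : V → E →L[ℝ] V →L[ℝ] E) (s : Set V) : Prop :=
  ∀ q ∈ s, ∀ x h k,
    fderiv ℝ A q h x k + A q (A q x h) k = fderiv ℝ A q k x h + A q (A q x k) h

/-- Picard iteration along the segments that issue from `q₀`. -/
def picardSeq (A : V → E →L[ℝ] V →L[ℝ] E) (q₀ : V) (x₀ : E) : ℕ → V → E
  | 0 => fun _ => x₀
  | n + 1 => fun q => x₀ + radialIntegral q₀ (fun p => A p (picardSeq A q₀ x₀ n p)) q

omit [ProperSpace V] [CompleteSpace E] in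
theorem norm_radialIntegral_sub_le {s : Set V} (hs : Convex ℝ s) {q₀ q : V} (h₀ : q₀ ∈ s)
    (hq : q ∈ s) {β β' : V → V →L[ℝ] E} (hβ : ContinuousOn β s) (hβ' : ContinuousOn β' s) {C : ℝ}
    (hC : ∀ p ∈ s, ‖β p - β' p‖ ≤ C) :
    ‖radialIntegral q₀ β q - radialIntegral q₀ β' q‖ ≤ C * ‖q - q₀‖ := by
  have hc : ∀ {η : V → V →L[ℝ] E}, ContinuousOn η s → IntervalIntegrable
      (fun t : ℝ => η (q₀ + t • (q - q₀)) (q - q₀)) volume 0 1 := fun hη =>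
    intervalIntegrable_of_continuousOn_Icc
      ((hη.comp (by fun_prop) fun t ht => segment_mem hs h₀ hq ht).clm_apply continuousOn_const)
  rw [radialIntegral, radialIntegral, ← intervalIntegral.integral_sub (hc hβ) (hc hβ')]
  have := intervalIntegral.norm_integral_le_of_norm_le_const (a := 0) (b := 1)
    (C := C * ‖q - q₀‖) (f := fun t : ℝ => β (q₀ + t • (q - q₀)) (q - q₀)
      - β' (q₀ + t • (q - q₀)) (q - q₀)) ?_
  · simpa only [sub_zero, abs_one, mul_one] using this
  intro t ht
  rw [uIoc_of_le zero_le_one] at ht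
  rw [← sub_apply]
  refine (ContinuousLinearMap.le_opNorm _ _).trans ?_
  gcongr
  exact hC _ (segment_mem hs h₀ hq (Ioc_subset_Icc_self ht))

theorem exists_isSolutionOn_of_small {s : Set V} (hs : Convex ℝ s) (ho : IsOpen s)
    {A : V → E →L[ℝ] V →L[ℝ] E} (hA : ContDiffOn ℝ 1 A s) (hflat : IsFlatOn A s) {M ρ : ℝ}
    (hM : ∀ q ∈ s, ‖A q‖ ≤ M) (hρ : ∀ q ∈ s, ∀ q' ∈ s, ‖q - q'‖ ≤ ρ) (hMρ : M * ρ ≤ 1 / 8)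
    {q₀ : V} (h₀ : q₀ ∈ s) (x₀ : E) : ∃ X : V → E, X q₀ = x₀ ∧ IsSolutionOn A s X := by
  have hM0 : 0 ≤ M := (norm_nonneg (A q₀)).trans (hM q₀ h₀)
  have hρ0 : 0 ≤ ρ := (norm_nonneg (q₀ - q₀)).trans (hρ q₀ h₀ q₀ h₀)
  set X := picardSeq A q₀ x₀ with hX
  have hAd : ∀ q ∈ s, HasFDerivAt A (fderiv ℝ A q) q := fun x hx =>
    ((hA.contDiffAt (ho.mem_nhds hx)).differentiableAt (by simp)).hasFDerivAt
  have hAle : ∀ q ∈ s, ∀ x, ‖A q x‖ ≤ M * ‖x‖ := fun q hq x =>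
    (A q).le_of_opNorm_le (hM q hq) x
  -- The induction tracks both the convergence of the iterates and the failure `e` of each to solve
  -- the equation. The new failure has two parts: `A (X n - X (n + 1))`, at most 1/8 of the old
  -- bound, and the radial error, at most `2 * M * ρ ≤ 1/4` of it. Their sum is below the required
  -- half.
  have main : ∀ n, ContDiffOn ℝ 1 (X n) s ∧
      (∀ q ∈ s, ‖X (n + 1) q - X n q‖ ≤ ‖x₀‖ / 2 / 2 ^ n) ∧
      ∀ q ∈ s, ∃ e : V →L[ℝ] E, HasFDerivAt (X n) (A q (X n q) + e) q ∧
        ‖e‖ ≤ 4 * M * ‖x₀‖ / 2 ^ n := by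
    intro n
    induction n with
    | zero =>
      refine ⟨contDiffOn_const, fun q hq => ?_, fun q hq => ⟨-A q x₀, ?_, ?_⟩⟩
      · have h := norm_radialIntegral_sub_le hs h₀ hq (β := fun p => A p x₀) (β' := fun _ => 0)
          (hA.continuousOn.clm_apply continuousOn_const) continuousOn_const (C := M * ‖x₀‖)
          (fun p hp => by simpa using hAle p hp x₀)
        have h' : ‖X 1 q - X 0 q‖ ≤ M * ‖x₀‖ * ‖q - q₀‖ := by
          simpa [hX, picardSeq, radialIntegral] using h
        have : M * ‖x₀‖ * ‖q - q₀‖ ≤ M * ‖x₀‖ * ρ := by gcongr; exact hρ q hq q₀ h₀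
        simp only [zero_add, pow_zero, div_one]
        nlinarith [norm_nonneg x₀]
      · simpa [hX, picardSeq] using hasFDerivAt_const x₀ q
      · rw [norm_neg]
        have := hAle q hq x₀
        have : 0 ≤ M * ‖x₀‖ := by positivity
        simp only [pow_zero, div_one]
        linarith
    | succ n ih =>
      obtain ⟨ih1, ih2, ih3⟩ := ih
      have hβ : ContDiffOn ℝ 1 (fun p => A p (X n p)) s := hA.clm_apply ih1
      have hdβ : ∀ q ∈ s, ∀ h k, ‖fderiv ℝ (fun p => A p (X n p)) q h k
          - fderiv ℝ (fun p => A p (X n p)) q k h‖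
          ≤ (2 * M * (4 * M * ‖x₀‖ / 2 ^ n)) * ‖h‖ * ‖k‖ := by
        intro q hq h k
        obtain ⟨e, he, hen⟩ := ih3 q hq
        rw [((hAd q hq).clm_apply he).fderiv]
        have h1 := hflat q hq (X n q) h k
        have h2 : ∀ h k, ‖A q (e h) k‖ ≤ M * (4 * M * ‖x₀‖ / 2 ^ n) * ‖h‖ * ‖k‖ := by
          intro h k
          calc ‖A q (e h) k‖ ≤ ‖A q (e h)‖ * ‖k‖ := ContinuousLinearMap.le_opNorm _ _
            _ ≤ (M * ‖e h‖) * ‖k‖ := by gcongr; exact hAle q hq _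
            _ ≤ (M * ((4 * M * ‖x₀‖ / 2 ^ n) * ‖h‖)) * ‖k‖ := by
                gcongr; exact e.le_of_opNorm_le hen h
            _ = _ := by ring
        have h3 : ∀ h k, ((A q).comp (A q (X n q) + e) +
            (ContinuousLinearMap.flip (fderiv ℝ A q)) (X n q)) h k
            = (fderiv ℝ A q h (X n q) k + A q (A q (X n q) h) k) + A q (e h) k := by
          intro h k
          simp
          abel
        -- Flatness cancels everything in the exterior derivative except the terms that contain `e`.
        rw [h3, h3, h1, add_sub_add_left_eq_sub]
        calc _ ≤ ‖A q (e h) k‖ + ‖A q (e k) h‖ := norm_sub_le _ _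
          _ ≤ _ := add_le_add (h2 h k) (h2 k h)
          _ = _ := by ring
      obtain ⟨r1, r2⟩ := hasFDerivAt_radialIntegral hs ho h₀ hβ hdβ (by positivity)
      have hX1 : X (n + 1) = fun q => x₀ + radialIntegral q₀ (fun p => A p (X n p)) q := rfl
      have hc1 : ContDiffOn ℝ 1 (X (n + 1)) s := by rw [hX1]; exact contDiffOn_const.add r1
      refine ⟨hc1, fun q hq => ?_, fun q hq => ?_⟩
      · have h := norm_radialIntegral_sub_le hs h₀ hq (hA.clm_apply hc1).continuousOn
          hβ.continuousOn (C := M * (‖x₀‖ / 2 / 2 ^ n)) (fun p hp => by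
            rw [← map_sub]
            exact (hAle p hp _).trans (by gcongr; exact ih2 p hp))
        have h' : ‖X (n + 1 + 1) q - X (n + 1) q‖ ≤ M * (‖x₀‖ / 2 / 2 ^ n) * ‖q - q₀‖ := by
          simpa [hX, picardSeq] using h
        have h2 : M * (‖x₀‖ / 2 / 2 ^ n) * ‖q - q₀‖ ≤ M * (‖x₀‖ / 2 / 2 ^ n) * ρ := by
          gcongr; exact hρ q hq q₀ h₀
        have h3 : 0 ≤ ‖x₀‖ / 2 / 2 ^ n := by positivity
        rw [pow_succ, ← div_div]
        nlinarith
      · obtain ⟨R, hR, hR'⟩ := r2 q hq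
        refine ⟨A q (X n q) - A q (X (n + 1) q) + R, ?_, ?_⟩
        · rw [hX1]
          refine (hR'.const_add x₀).congr_fderiv ?_
          abel
        · have h1 : ‖A q (X n q) - A q (X (n + 1) q)‖ ≤ M * (‖x₀‖ / 2 / 2 ^ n) := by
            rw [← map_sub]
            refine (hAle q hq _).trans ?_
            rw [norm_sub_rev]
            gcongr
            exact ih2 q hq
          have h2 : ‖R‖ ≤ 2 * M * (4 * M * ‖x₀‖ / 2 ^ n) * ρ :=
            hR.trans (by gcongr; exact hρ q hq q₀ h₀)
          have h3 := norm_add_le (A q (X n q) - A q (X (n + 1) q)) R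
          have h4 : 0 ≤ M * (‖x₀‖ / 2 ^ n) := by positivity
          have e1 : M * (‖x₀‖ / 2 / 2 ^ n) = M * (‖x₀‖ / 2 ^ n) / 2 := by ring
          have e2 : 2 * M * (4 * M * ‖x₀‖ / 2 ^ n) * ρ = 8 * (M * ρ) * (M * (‖x₀‖ / 2 ^ n)) := by
            ring
          have e3 : 4 * M * ‖x₀‖ / 2 ^ (n + 1) = 2 * (M * (‖x₀‖ / 2 ^ n)) := by
            rw [pow_succ]; field_simp; ring
          rw [e3]
          nlinarith
  have hcau : ∀ q ∈ s, ∀ n, dist (X n q) (X (n + 1) q) ≤ ‖x₀‖ / 2 / 2 ^ n := by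
    intro q hq n
    rw [dist_comm, dist_eq_norm]
    exact (main n).2.1 q hq
  have hlim : ∀ q ∈ s, ∃ y, Tendsto (fun n => X n q) atTop (𝓝 y) := fun q hq =>
    cauchySeq_tendsto_of_complete (cauchySeq_of_le_geometric_two (hcau q hq))
  classical
  choose! Y hY using hlim
  have hYd : ∀ q ∈ s, ∀ n, dist (X n q) (Y q) ≤ ‖x₀‖ / 2 ^ n := fun q hq n =>
    dist_le_of_le_geometric_two_of_tendsto (hcau q hq) (hY q hq) n
  refine ⟨Y, ?_, fun q hq => ?_⟩
  · refine tendsto_nhds_unique (hY q₀ h₀) ?_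
    refine tendsto_const_nhds.congr fun n => ?_
    cases n <;> simp [hX, picardSeq, radialIntegral]
  · have hd : ∀ n, ∀ q ∈ s, HasFDerivAt (X n) (fderiv ℝ (X n) q) q := fun n q hq => by
      obtain ⟨e, he, -⟩ := (main n).2.2 q hq
      exact he.differentiableAt.hasFDerivAt
    refine hasFDerivAt_of_tendstoUniformlyOn (f' := fun n => fderiv ℝ (X n))
      (g' := fun q => A q (Y q)) (l := atTop) ho ?_ hd hY hq
    rw [Metric.tendstoUniformlyOn_iff]
    intro ε hε
    -- The factor 5 is 1 from the distance of `X n` to its limit plus 4 from the bound on `e`.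
    have hl : Tendsto (fun n : ℕ => 5 * M * ‖x₀‖ * (1 / 2) ^ n) atTop (𝓝 0) := by
      simpa using (tendsto_pow_atTop_nhds_zero_of_lt_one (r := (1 : ℝ) / 2) (by norm_num)
        (by norm_num)).const_mul (5 * M * ‖x₀‖)
    filter_upwards [hl.eventually_lt_const hε] with n hn q hq
    refine lt_of_le_of_lt ?_ hn
    obtain ⟨e, he, hen⟩ := (main n).2.2 q hq
    rw [he.fderiv, dist_comm, dist_eq_norm]
    have h1 : ‖A q (X n q) - A q (Y q)‖ ≤ M * (‖x₀‖ / 2 ^ n) := by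
      rw [← map_sub]
      refine (hAle q hq _).trans ?_
      gcongr
      rw [← dist_eq_norm]
      exact hYd q hq n
    have h2 : A q (X n q) + e - A q (Y q) = (A q (X n q) - A q (Y q)) + e := by abel
    rw [h2]
    refine (norm_add_le _ _).trans ((add_le_add h1 hen).trans (le_of_eq ?_))
    rw [one_div, inv_pow]
    ring

end TotalDifferential

/-! ### Uniqueness, regularity and global existence of solutions. -/

/-- A copy of a type with the discrete topology. -/
def DiscreteCopy (E : Type*) : Type _ := E

instance (E : Type*) : TopologicalSpace (DiscreteCopy E) := ⊥

instance (E : Type*) : DiscreteTopology (DiscreteCopy E) := ⟨rfl⟩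

section TotalDifferential

variable {V E : Type*} [NormedAddCommGroup V] [NormedSpace ℝ V]
  [NormedAddCommGroup E] [NormedSpace ℝ E]

theorem IsSolutionOn.mono {A : V → E →L[ℝ] V →L[ℝ] E} {s t : Set V} {X : V → E}
    (h : IsSolutionOn A s X) (hts : t ⊆ s) : IsSolutionOn A t X := fun q hq => h q (hts hq)

theorem IsSolutionOn.sub {A : V → E →L[ℝ] V →L[ℝ] E} {s : Set V} {X Y : V → E}
    (hX : IsSolutionOn A s X) (hY : IsSolutionOn A s Y) :
    IsSolutionOn A s (X - Y) := fun q hq =>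
  ((hX q hq).sub (hY q hq)).congr_fderiv (by simp)

theorem exists_ball_norm_le {A : V → E →L[ℝ] V →L[ℝ] E} {s : Set V} (ho : IsOpen s)
    (hA : ContinuousOn A s) {p : V} (hp : p ∈ s) :
    ∃ r > 0, Metric.ball p r ⊆ s ∧ ∀ q ∈ Metric.ball p r, ‖A q‖ ≤ ‖A p‖ + 1 := by
  have hm : ∀ᶠ q in 𝓝 p, q ∈ s := ho.mem_nhds hp
  have hn : ContinuousAt (fun q => ‖A q‖) p :=
    (continuous_norm (E := E →L[ℝ] V →L[ℝ] E)).continuousAt.comp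
      (hA.continuousAt (ho.mem_nhds hp))
  have h : ∀ᶠ q in 𝓝 p, q ∈ s ∧ ‖A q‖ < ‖A p‖ + 1 :=
    hm.and
      (hn.eventually_lt_const (lt_add_one ‖A p‖))
  obtain ⟨r, hr, hb⟩ := Metric.eventually_nhds_iff_ball.mp h
  exact ⟨r, hr, fun q hq => (hb q hq).1, fun q hq => (hb q hq).2.le⟩

/-- Along each segment issuing from `p`, the solution satisfies a linear differential inequality
with bounded coefficient and zero initial value, so Grönwall's inequality applies. -/
theorem IsSolutionOn.eventually_eq_zero {A : V → E →L[ℝ] V →L[ℝ] E} {s : Set V} (ho : IsOpen s)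
    (hA : ContinuousOn A s) {X : V → E} (hX : IsSolutionOn A s X) {p : V} (hp : p ∈ s)
    (h0 : X p = 0) : ∀ᶠ q in 𝓝 p, X q = 0 := by
  obtain ⟨r, hr, hs, hM⟩ := exists_ball_norm_le ho hA hp
  filter_upwards [Metric.ball_mem_nhds p hr] with x hx
  have hmem : ∀ t ∈ Icc (0 : ℝ) 1, p + t • (x - p) ∈ Metric.ball p r := fun t ht =>
    segment_mem (convex_ball p r) (Metric.mem_ball_self hr) hx ht
  have hd : ∀ t ∈ Icc (0 : ℝ) 1, HasDerivAt (fun t : ℝ => X (p + t • (x - p)))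
      (A (p + t • (x - p)) (X (p + t • (x - p))) (x - p)) t := by
    intro t ht
    have h1 : HasDerivAt (fun t : ℝ => p + t • (x - p)) (x - p) t := by
      simpa using ((hasDerivAt_id t).smul_const (x - p)).const_add p
    exact (hX _ (hs (hmem t ht))).comp_hasDerivAt t h1
  have := eq_zero_of_abs_deriv_le_mul_abs_self_of_eq_zero_right (a := 0) (b := 1)
    (f := fun t : ℝ => X (p + t • (x - p)))
    (f' := fun t : ℝ => A (p + t • (x - p)) (X (p + t • (x - p))) (x - p))
    (K := (‖A p‖ + 1) * ‖x - p‖)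
    (fun t ht => (hd t ht).continuousAt.continuousWithinAt)
    (fun t ht => (hd t (Ico_subset_Icc_self ht)).hasDerivWithinAt) (by simpa using h0)
    (fun t ht => by
      refine (ContinuousLinearMap.le_opNorm _ _).trans ?_
      have h1 := (A (p + t • (x - p))).le_of_opNorm_le
        (hM _ (hmem t (Ico_subset_Icc_self ht))) (X (p + t • (x - p)))
      nlinarith [norm_nonneg (x - p)]) 1 (by simp)
  simpa using this

/-- Two solutions of `dX = A X` that agree at one point of a connected open set agree on it. -/
theorem IsSolutionOn.eqOn {A : V → E →L[ℝ] V →L[ℝ] E} {s : Set V} (ho : IsOpen s)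
    (hc : IsPreconnected s) (hA : ContinuousOn A s) {X Y : V → E} (hX : IsSolutionOn A s X)
    (hY : IsSolutionOn A s Y) {p : V} (hp : p ∈ s) (h : X p = Y p) : EqOn X Y s := by
  have hZ := hX.sub hY
  -- The set of points near which the difference vanishes is open, nonempty and relatively closed in
  -- `s`.
  have hsub : s ⊆ {q | ∀ᶠ x in 𝓝 q, (X - Y) x = 0} := by
    refine hc.subset_of_closure_inter_subset (isOpen_iff_mem_nhds.mpr fun q hq => ?_)
      ⟨p, hp, hZ.eventually_eq_zero ho hA hp (by simp [h])⟩ fun q hq => ?_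
    · exact eventually_eventually_nhds.mpr hq
    · refine hZ.eventually_eq_zero ho hA hq.2 ?_
      have hfr : ∃ᶠ x in 𝓝 q, (X - Y) x = 0 :=
        (mem_closure_iff_frequently.mp hq.1).mono fun x hx => hx.self_of_nhds
      by_contra hne
      exact hfr ((hZ q hq.2).continuousAt.eventually_ne hne)
  exact fun q hq => sub_eq_zero.mp (hsub hq).self_of_nhds

/-- Bootstrapping: the derivative `A X` is as smooth as `X`. -/
theorem IsSolutionOn.contDiffOn {A : V → E →L[ℝ] V →L[ℝ] E} {s : Set V} (ho : IsOpen s)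
    (hA : ContDiffOn ℝ ∞ A s) {X : V → E} (hX : IsSolutionOn A s X) : ContDiffOn ℝ ∞ X s := by
  rw [contDiffOn_infty]
  intro n
  induction n with
  | zero => exact contDiffOn_zero.mpr fun q hq => (hX q hq).continuousAt.continuousWithinAt
  | succ n ih =>
    rw [Nat.cast_succ, contDiffOn_succ_iff_fderiv_of_isOpen ho]
    refine ⟨fun q hq => (hX q hq).differentiableAt.differentiableWithinAt, by simp, ?_⟩
    exact ((hA.of_le (by exact_mod_cast le_top)).clm_apply ih).congr
      fun q hq => (hX q hq).fderiv

variable [ProperSpace V] [CompleteSpace E]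

/-- One ball serves all base points `q` in it and all initial values; this makes the transition maps
of the covering space below well defined. -/
theorem exists_ball_isSolutionOn {A : V → E →L[ℝ] V →L[ℝ] E} {s : Set V} (ho : IsOpen s)
    (hA : ContDiffOn ℝ 1 A s) (hflat : IsFlatOn A s) {p : V} (hp : p ∈ s) :
    ∃ r > 0, Metric.ball p r ⊆ s ∧ ∀ q ∈ Metric.ball p r, ∀ x₀ : E,
      ∃ X : V → E, X q = x₀ ∧ IsSolutionOn A (Metric.ball p r) X := by
  obtain ⟨r, hr, hs, hM⟩ := exists_ball_norm_le ho hA.continuousOn hp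
  have hpos : 0 < ‖A p‖ + 1 := by positivity
  -- The ball has diameter at most `2 * r'`, so 16 yields the bound 1/8 that the iteration needs.
  set r' := min r (1 / (16 * (‖A p‖ + 1))) with hr'
  have hsub : Metric.ball p r' ⊆ Metric.ball p r := Metric.ball_subset_ball (min_le_left _ _)
  refine ⟨r', lt_min hr (by positivity), hsub.trans hs, fun q hq x₀ => ?_⟩
  refine exists_isSolutionOn_of_small (convex_ball p r') Metric.isOpen_ball
    (hA.mono (hsub.trans hs)) (fun q hq => hflat q (hs (hsub hq))) (M := ‖A p‖ + 1)
    (ρ := 2 * r') (fun q hq => hM q (hsub hq)) (fun q hq q' hq' => ?_) ?_ hq x₀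
  · rw [← dist_eq_norm]
    have := dist_triangle_right q q' p
    rw [Metric.mem_ball] at hq hq'
    linarith
  · have h1 : r' ≤ 1 / (16 * (‖A p‖ + 1)) := min_le_right _ _
    have h2 : (‖A p‖ + 1) * r' ≤ (‖A p‖ + 1) * (1 / (16 * (‖A p‖ + 1))) := by gcongr
    have h3 : (‖A p‖ + 1) * (1 / (16 * (‖A p‖ + 1))) = 1 / 16 := by field_simp
    linarith

/-- An integrable linear total differential equation on a simply connected open set has a
solution with any given value at a point. -/
theorem exists_isSolutionOn {A : V → E →L[ℝ] V →L[ℝ] E} {s : Set V} (ho : IsOpen s)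
    [SimplyConnectedSpace s] (hA : ContDiffOn ℝ 1 A s) (hflat : IsFlatOn A s) {p₀ : V}
    (hp₀ : p₀ ∈ s) (x₀ : E) : ∃ X : V → E, X p₀ = x₀ ∧ IsSolutionOn A s X := by
  classical
  choose! r hr hrs S hS hSs using
    fun (p : V) (hp : p ∈ s) => exists_ball_isSolutionOn ho hA hflat hp
  let U : s → Set V := fun p => Metric.ball p (r p)
  have hUs : ∀ i : s, U i ⊆ s := fun i => hrs i i.2
  have hself : ∀ i : s, (i : V) ∈ U i := fun i => Metric.mem_ball_self (hr i i.2)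
  have hval : ∀ i : s, ∀ q ∈ U i, ∀ x, S i q x q = x := fun i => hS i i.2
  have hsol : ∀ i : s, ∀ q ∈ U i, ∀ x, IsSolutionOn A (U i) (S i q x) := fun i => hSs i i.2
  have huniq : ∀ (i : s) {X Y : V → E}, IsSolutionOn A (U i) X → IsSolutionOn A (U i) Y →
      ∀ q ∈ U i, X q = Y q → EqOn X Y (U i) := fun i X Y hX hY q hq h =>
    hX.eqOn Metric.isOpen_ball (convex_ball _ _).isPreconnected
      (hA.continuousOn.mono (hUs i)) hY hq h
  have hcenter : ∀ (i : s) {X : V → E}, IsSolutionOn A (U i) X → ∀ q ∈ U i,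
      S i q (X q) i = X i := fun i X hX q hq =>
    huniq i (hsol i q hq _) hX q hq (hval i q hq _) (hself i)
  -- The space of germs of solutions, as a bundle with discrete fibre. The chart `i` records the
  -- value at the centre of `U i` of the solution through the given point. As `indexAt` is the
  -- identity, the fibre coordinate of a germ at `q` is its value at `q`.
  let Z : FiberBundleCore s s (DiscreteCopy E) :=
    { baseSet := fun i => Subtype.val ⁻¹' U i
      isOpen_baseSet := fun i => Metric.isOpen_ball.preimage continuous_subtype_val
      indexAt := id
      mem_baseSet_at := hself
      coordChange := fun i j x v => S j x (S i i v x) j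
      coordChange_self := fun i x hx v => by
        exact (hcenter i (hsol i i (hself i) v) x hx).trans (hval i i (hself i) v)
      continuousOn_coordChange := fun i j => by
        rintro ⟨x, v⟩ ⟨hx, -⟩
        let c : DiscreteCopy E := S j x (S i i v x) j
        have hc : ContinuousWithinAt (fun _ : s × DiscreteCopy E => c)
            ((Subtype.val ⁻¹' U i ∩ Subtype.val ⁻¹' U j) ×ˢ univ) (x, v) :=
          continuousWithinAt_const
        refine hc.congr_of_eventuallyEq ?_ rfl
        have h1 : ∀ᶠ z : s × DiscreteCopy E in
            𝓝[(Subtype.val ⁻¹' U i ∩ Subtype.val ⁻¹' U j) ×ˢ univ] (x, v), z.2 = v :=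
          nhdsWithin_le_nhds (continuous_snd.continuousAt.eventually
            (p := fun w => w = v) (by simp [nhds_discrete]))
        filter_upwards [h1, self_mem_nhdsWithin] with z hz hzm
        obtain ⟨y, w⟩ := z
        obtain rfl : w = v := hz
        -- Two balls meet in a convex set, on which the two local solutions agree; hence the
        -- transition map does not depend on the base point.
        have hagree : S i i w y = S j x (S i i w x) y :=
          IsSolutionOn.eqOn (Metric.isOpen_ball.inter Metric.isOpen_ball)
            ((convex_ball _ _).inter (convex_ball _ _)).isPreconnected
            (hA.continuousOn.mono (inter_subset_left.trans (hUs i)))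
            ((hsol i i (hself i) w).mono inter_subset_left)
            ((hsol j x hx.2 _).mono inter_subset_right) (p := x) hx
            (hval j x hx.2 _).symm hzm.1
        change S j y (S i i w y) j = S j x (S i i w x) j
        rw [hagree]
        exact hcenter j (hsol j x hx.2 _) y hzm.1.2
      coordChange_comp := fun i j k x hx v => by
        change S k x (S j j (S j x (S i i v x) j) x) k = S k x (S i i v x) k
        have : S j j (S j x (S i i v x) j) x = S i i v x := by
          rw [huniq j (hsol j j (hself j) _) (hsol j x hx.1.2 (S i i v x)) j (hself j)
            (hval j j (hself j) _) hx.1.2]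
          exact hval j x hx.1.2 _
        rw [this] }
  have hcov : IsCoveringMap Z.proj :=
    IsCoveringMap.mk Z.proj (fun _ => DiscreteCopy E) (fun x => Z.localTriv x)
      (fun x => hself x)
  have : LocallyPathConnectedSpace s := ho.locallyPathConnectedSpace
  -- Since `s` is simply connected, its identity map lifts to a global section of the covering.
  obtain ⟨F, ⟨hF0, hF⟩, -⟩ := hcov.existsUnique_continuousMap_lifts (ContinuousMap.id s)
    ⟨p₀, hp₀⟩ (⟨⟨p₀, hp₀⟩, x₀⟩ : Bundle.TotalSpace (DiscreteCopy E) Z.Fiber) rfl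
  have hFq : ∀ q : s, (F q).1 = q := fun q => congrFun hF q
  let X : V → E := fun q => if h : q ∈ s then (F ⟨q, h⟩).2 else 0
  let f : Z.TotalSpace → E := fun z => z.2
  have hXs : ∀ q : s, X q = f (F q) := fun q => dif_pos q.2
  refine ⟨X, ?_, fun p hp => ?_⟩
  · rw [hXs ⟨p₀, hp₀⟩, hF0]
  let i : s := ⟨p, hp⟩
  let e := Z.localTriv i
  have hsrc : F i ∈ e.source := by
    rw [Z.mem_localTriv_source, hFq i]; exact hself i
  have hcont : ContinuousAt (fun q => (e (F q)).2) i :=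
    continuous_snd.continuousAt.comp ((e.continuousAt hsrc).comp F.continuous.continuousAt)
  have hev : ∀ᶠ q in 𝓝 i, (e (F q)).2 = (e (F i)).2 :=
    hcont.eventually (p := fun w => w = (e (F i)).2) (by simp [nhds_discrete])
  have hcoord : ∀ q : s, (e (F q)).2 = S i q (X q) i := fun q => by
    have h1 : ∀ z : Z.TotalSpace, (e z).2 = S i z.1 (f z) i := fun z => by
      have h2 : (e z).2 = S i z.1 (S z.1 z.1 (f z) z.1) i := rfl
      rw [h2, hval z.1 _ (hself _)]
    rw [h1, hXs, hFq]
  -- The coordinate of a continuous section in a chart with discrete fibre is locally constant, so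
  -- near `p` the section follows a single local solution.
  have hev' : ∀ᶠ q in 𝓝 p, X q = S i i (X i) q := by
    have h2 : ∀ᶠ q : s in 𝓝 i, X q = S i i (X i) q := by
      have h3 : ∀ᶠ q : s in 𝓝 i, (q : V) ∈ U i :=
        continuous_subtype_val.continuousAt.eventually (Metric.isOpen_ball.mem_nhds (hself i))
      filter_upwards [hev, h3] with q hq hqU
      rw [hcoord, hcoord, hval i i (hself i)] at hq
      have := huniq i (hsol i q hqU (X q)) (hsol i i (hself i) (X i)) i (hself i)
        (hq.trans (hval i i (hself i) _).symm) hqU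
      rwa [hval i q hqU] at this
    rw [← map_nhds_subtype_coe_eq_nhds hp (ho.mem_nhds hp)]
    exact h2
  have h1 := hsol i i (hself i) (X i) p (hself i)
  rw [← hev'.self_of_nhds] at h1
  exact h1.congr_of_eventuallyEq hev'

end TotalDifferential

/-! ### Linear systems given by matrices of 1-forms on the plane. -/

section ConnectionMatrix

variable {n : ℕ}

/-- The operator-valued `1`-form with a given matrix of `1`-forms. -/
def matrixForm (Ω : Fin n → Fin n → OneForm) (q : ℝ × ℝ) :
    (Fin n → ℝ) →L[ℝ] ℝ × ℝ →L[ℝ] Fin n → ℝ :=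
  ∑ j, ∑ k, ((ContinuousLinearMap.smulRightL ℝ (Fin n → ℝ) (ℝ × ℝ →L[ℝ] Fin n → ℝ)
    (ContinuousLinearMap.proj k)).comp
      ((ContinuousLinearMap.smulRightL ℝ (ℝ × ℝ) (Fin n → ℝ)).flip (Pi.single j 1))) (Ω j k q)

theorem matrixForm_apply (Ω : Fin n → Fin n → OneForm) (q : ℝ × ℝ) (x : Fin n → ℝ) (h : ℝ × ℝ)
    (i : Fin n) : matrixForm Ω q x h i = ∑ k, x k * Ω i k q h := by
  simp [matrixForm, Finset.sum_apply, Pi.single_apply]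

theorem contDiffOn_matrixForm {Ω : Fin n → Fin n → OneForm} {s : Set (ℝ × ℝ)}
    (hΩ : ∀ j k, ContDiffOn ℝ ∞ (Ω j k) s) : ContDiffOn ℝ ∞ (matrixForm Ω) s := by
  unfold matrixForm
  exact ContDiffOn.sum fun j _ => ContDiffOn.sum fun k _ =>
    (ContinuousLinearMap.contDiff _).comp_contDiffOn (hΩ j k)

theorem isSolutionOn_matrixForm_iff {Ω : Fin n → Fin n → OneForm} {s : Set (ℝ × ℝ)}
    {X : Fin n → ℝ × ℝ → ℝ} : IsSolutionOn (matrixForm Ω) s (fun q j => X j q) ↔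
      ∀ q ∈ s, ∀ j, HasFDerivAt (X j) (∑ k, X k q • Ω j k q) q := by
  have h : ∀ q j, (ContinuousLinearMap.proj j).comp (matrixForm Ω q (fun j => X j q)) =
      ∑ k, X k q • Ω j k q := by
    intro q j
    refine ContinuousLinearMap.ext fun v => ?_
    simp [matrixForm_apply]
  constructor
  · intro hX q hq j
    rw [← h]
    exact hasFDerivAt_pi'.mp (hX q hq) j
  · intro hX q hq
    refine hasFDerivAt_pi'.mpr fun j => ?_
    rw [h]
    exact hX q hq j

theorem symm_of_basis {F : Type*} [NormedAddCommGroup F] [NormedSpace ℝ F]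
    (L : ℝ × ℝ →L[ℝ] ℝ × ℝ →L[ℝ] F) (h : L (1, 0) (0, 1) = L (0, 1) (1, 0)) (u v : ℝ × ℝ) :
    L u v = L v u := by
  have key : ∀ w : ℝ × ℝ, w = w.1 • ((1, 0) : ℝ × ℝ) + w.2 • ((0, 1) : ℝ × ℝ) := fun w => by
    simp
  rw [key u, key v]
  simp only [map_add, map_smul, add_apply, smul_apply, h, smul_add, smul_smul]
  rw [mul_comm v.1 u.1, mul_comm v.2 u.1, mul_comm v.1 u.2, mul_comm v.2 u.2]
  abel

/-- Existence for integrable linear systems `dXⱼ = ∑ₖ Xₖ Ωⱼₖ` on a simply connected open set. -/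
theorem exists_solution_of_flat {s : Set (ℝ × ℝ)} (ho : IsOpen s) [SimplyConnectedSpace s]
    {Ω : Fin n → Fin n → OneForm} (hΩ : ∀ j k, ContDiffOn ℝ ∞ (Ω j k) s)
    (hflat : ∀ p ∈ s, ∀ X : Fin n → ℝ × ℝ → ℝ, (∀ j, ContDiff ℝ ∞ (X j)) →
      (∀ j, HasFDerivAt (X j) (∑ k, X k p • Ω j k p) p) →
      ∀ j, extD (fun q => ∑ k, X k q • Ω j k q) p = 0)
    {p₀ : ℝ × ℝ} (hp₀ : p₀ ∈ s) (x₀ : Fin n → ℝ) :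
    ∃ X : Fin n → ℝ × ℝ → ℝ, (∀ j, ContDiffOn ℝ ∞ (X j) s) ∧ (∀ j, X j p₀ = x₀ j) ∧
      ∀ q ∈ s, ∀ j, HasFDerivAt (X j) (∑ k, X k q • Ω j k q) q := by
  have hA := contDiffOn_matrixForm hΩ
  have hfl : IsFlatOn (matrixForm Ω) s := by
    intro p hp x
    -- Flatness at `p` involves only the 1-jet of a solution there, so it can be tested on the
    -- affine functions that have the prescribed value and derivative at `p`.
    let X : Fin n → ℝ × ℝ → ℝ := fun j q => x j + (∑ k, x k • Ω j k p) (q - p)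
    have hX0 : ∀ j, X j p = x j := fun j => by simp [X]
    have hXd : ∀ j, HasFDerivAt (X j) (∑ k, X k p • Ω j k p) p := fun j => by
      simp only [hX0]
      have h1 : HasFDerivAt (fun q => q - p) (ContinuousLinearMap.id ℝ (ℝ × ℝ)) p :=
        (hasFDerivAt_id p).sub_const p
      exact ((∑ k, x k • Ω j k p).hasFDerivAt.comp p h1).const_add (x j)
    have hXs : ∀ j, ContDiff ℝ ∞ (X j) := fun j =>
      contDiff_const.add ((∑ k, x k • Ω j k p).contDiff.comp (contDiff_id.sub contDiff_const))
    have hvec : HasFDerivAt (fun q j => X j q) (matrixForm Ω p x) p := by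
      have := (isSolutionOn_matrixForm_iff (s := {p}) (Ω := Ω) (X := X)).mpr
        (by simpa using hXd) p rfl
      simpa only [hX0] using this
    have hAd : HasFDerivAt (matrixForm Ω) (fderiv ℝ (matrixForm Ω) p) p :=
      ((hA.contDiffAt (ho.mem_nhds hp)).differentiableAt (by simp)).hasFDerivAt
    have hprod := hAd.clm_apply hvec
    simp only [hX0] at hprod
    set L := (matrixForm Ω p).comp (matrixForm Ω p x) +
      (ContinuousLinearMap.flip (fderiv ℝ (matrixForm Ω) p)) x with hL
    have hLa : ∀ h k, L h k = fderiv ℝ (matrixForm Ω) p h x k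
        + matrixForm Ω p (matrixForm Ω p x h) k := fun h k => by
      simp [hL, add_comm]
    intro h k
    rw [← hLa, ← hLa]
    refine symm_of_basis L ?_ h k
    funext j
    have hc : HasFDerivAt (fun q => ∑ k, X k q • Ω j k q)
        ((ContinuousLinearMap.compL ℝ (ℝ × ℝ) (Fin n → ℝ) ℝ (ContinuousLinearMap.proj j)).comp L)
        p := by
      have h1 := ((ContinuousLinearMap.compL ℝ (ℝ × ℝ) (Fin n → ℝ) ℝ
        (ContinuousLinearMap.proj j)).hasFDerivAt).comp p hprod
      refine h1.congr_of_eventuallyEq (Eventually.of_forall fun q => ?_)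
      refine ContinuousLinearMap.ext fun v => ?_
      simp [matrixForm_apply]
    have h2 := hflat p hp X hXs hXd j
    rw [extD, hc.fderiv, sub_eq_zero] at h2
    simpa using h2
  obtain ⟨Y, hY0, hY⟩ := exists_isSolutionOn ho (hA.of_le (by exact_mod_cast le_top)) hfl hp₀ x₀
  have hYs := contDiffOn_pi.mp (hY.contDiffOn ho hA)
  exact ⟨fun j q => Y q j, hYs, fun j => congrFun hY0 j, isSolutionOn_matrixForm_iff.mp hY⟩

theorem eqOn_zero_of_solution {s : Set (ℝ × ℝ)} (ho : IsOpen s) (hs : IsPreconnected s)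
    {Ω : Fin n → Fin n → OneForm} (hΩ : ∀ j k, ContDiffOn ℝ ∞ (Ω j k) s)
    {X : Fin n → ℝ × ℝ → ℝ} (hX : ∀ q ∈ s, ∀ j, HasFDerivAt (X j) (∑ k, X k q • Ω j k q) q)
    {p₀ : ℝ × ℝ} (hp₀ : p₀ ∈ s) (h0 : ∀ j, X j p₀ = 0) : ∀ q ∈ s, ∀ j, X j q = 0 := by
  have h1 := isSolutionOn_matrixForm_iff.mpr hX
  have h2 : IsSolutionOn (matrixForm Ω) s (fun _ => (0 : Fin n → ℝ)) := fun q _ =>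
    (hasFDerivAt_const (0 : Fin n → ℝ) q).congr_fderiv (map_zero _).symm
  have := h1.eqOn ho hs (contDiffOn_matrixForm hΩ).continuousOn h2 hp₀ (funext h0)
  exact fun q hq j => congrFun (this hq) j

end ConnectionMatrix

/-! ### Exterior calculus and covariant derivatives of weighted functions. -/

theorem oneForm_ext {α β : ℝ × ℝ →L[ℝ] ℝ} (h1 : α (1, 0) = β (1, 0)) (h2 : α (0, 1) = β (0, 1)) :
    α = β := by
  ext
  · simpa using h1
  · simpa using h2

theorem extD_congr {α β : OneForm} {p : ℝ × ℝ} (h : α =ᶠ[𝓝 p] β) : extD α p = extD β p := by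
  simp only [extD, h.fderiv_eq]

theorem extD_smul {b : ℝ × ℝ → ℝ} {α : OneForm} {p : ℝ × ℝ} (hb : DifferentiableAt ℝ b p)
    (hα : DifferentiableAt ℝ α p) : extD (fun q => b q • α q) p =
      b p * extD α p + (fderiv ℝ b p (1, 0) * α p (0, 1) - fderiv ℝ b p (0, 1) * α p (1, 0)) := by
  have h : fderiv ℝ (fun q => b q • α q) p =
      b p • fderiv ℝ α p + (fderiv ℝ b p).smulRight (α p) := fderiv_fun_smul hb hα
  simp only [extD, h, add_apply, smul_apply, ContinuousLinearMap.smulRight_apply, smul_eq_mul]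
  ring

theorem contDiffOn_wedge {α β : OneForm} {s : Set (ℝ × ℝ)} (hα : ContDiffOn ℝ ∞ α s)
    (hβ : ContDiffOn ℝ ∞ β s) : ContDiffOn ℝ ∞ (wedge α β) s := by
  have h : ∀ {η : OneForm}, ContDiffOn ℝ ∞ η s → ∀ v, ContDiffOn ℝ ∞ (fun q => η q v) s :=
    fun hη v => hη.clm_apply contDiffOn_const
  exact ((h hα _).mul (h hβ _)).sub ((h hα _).mul (h hβ _))

theorem contDiffOn_extD {α : OneForm} {s : Set (ℝ × ℝ)} (ho : IsOpen s)
    (hα : ContDiffOn ℝ ∞ α s) : ContDiffOn ℝ ∞ (extD α) s := by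
  have h : ContDiffOn ℝ ∞ (fderiv ℝ α) s := hα.fderiv_of_isOpen ho (by simp)
  exact ((h.clm_apply contDiffOn_const).clm_apply contDiffOn_const).sub
    ((h.clm_apply contDiffOn_const).clm_apply contDiffOn_const)

namespace Normalization

variable {W : PlanarWeb 4} (N : Normalization W)

/-! ### Smoothness -/

theorem contDiffOn_inv_wedge : ContDiffOn ℝ ∞ (fun q => (wedge N.ω₁ N.ω₂ q)⁻¹) W.domain :=
  (contDiffOn_wedge N.smooth₁ N.smooth₂).inv fun _ hq => N.wedge_ne_zero hq

theorem contDiffOn_frame₁ : ContDiffOn ℝ ∞ N.frame₁ W.domain :=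
  N.contDiffOn_inv_wedge.smul ((N.smooth₂.clm_apply contDiffOn_const).prodMk
    (N.smooth₂.clm_apply contDiffOn_const).neg)

theorem contDiffOn_frame₂ : ContDiffOn ℝ ∞ N.frame₂ W.domain :=
  N.contDiffOn_inv_wedge.smul ((N.smooth₁.clm_apply contDiffOn_const).neg.prodMk
    (N.smooth₁.clm_apply contDiffOn_const))

theorem contDiffOn_g₁ : ContDiffOn ℝ ∞ N.g₁ W.domain :=
  ((contDiffOn_extD W.domain.isOpen N.smooth₂).div (contDiffOn_wedge N.smooth₁ N.smooth₂)
    fun _ hq => N.wedge_ne_zero hq).neg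

theorem contDiffOn_g₂ : ContDiffOn ℝ ∞ N.g₂ W.domain :=
  (contDiffOn_extD W.domain.isOpen N.smooth₁).div (contDiffOn_wedge N.smooth₁ N.smooth₂)
    fun _ hq => N.wedge_ne_zero hq

theorem contDiffOn_γ : ContDiffOn ℝ ∞ N.γ W.domain :=
  (N.contDiffOn_g₁.smul N.smooth₁).add (N.contDiffOn_g₂.smul N.smooth₂)

theorem contDiffOn_K : ContDiffOn ℝ ∞ N.K W.domain :=
  (contDiffOn_extD W.domain.isOpen N.contDiffOn_γ).div (contDiffOn_wedge N.smooth₁ N.smooth₂)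
    fun _ hq => N.wedge_ne_zero hq

theorem contDiffOn_δ₁ (w : ℕ) {f : ℝ × ℝ → ℝ} (hf : ContDiffOn ℝ ∞ f W.domain) :
    ContDiffOn ℝ ∞ (N.δ₁ w f) W.domain :=
  ((hf.fderiv_of_isOpen W.domain.isOpen (by simp)).clm_apply N.contDiffOn_frame₁).sub
    ((contDiffOn_const.mul N.contDiffOn_g₁).mul hf)

theorem contDiffOn_δ₂ (w : ℕ) {f : ℝ × ℝ → ℝ} (hf : ContDiffOn ℝ ∞ f W.domain) :
    ContDiffOn ℝ ∞ (N.δ₂ w f) W.domain :=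
  ((hf.fderiv_of_isOpen W.domain.isOpen (by simp)).clm_apply N.contDiffOn_frame₂).sub
    ((contDiffOn_const.mul N.contDiffOn_g₂).mul hf)

variable {N}

theorem _root_.PlanarWebs.PlanarWeb.differentiableAt_of_contDiffOn {d : ℕ} {W : PlanarWeb d}
    {F : Type*} [NormedAddCommGroup F]
    [NormedSpace ℝ F] {f : ℝ × ℝ → F} (hf : ContDiffOn ℝ ∞ f W.domain) {p : ℝ × ℝ}
    (hp : p ∈ W.domain) : DifferentiableAt ℝ f p :=
  (hf.contDiffAt (W.domain.isOpen.mem_nhds hp)).differentiableAt (by simp)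

variable (N)

/-! ### First-order jets of weighted functions -/

/-- The value and the covariant derivatives at `p` of a function `f` of weight `w`. -/
structure Jet (w : ℕ) (f : ℝ × ℝ → ℝ) (p : ℝ × ℝ) (x d₁ d₂ : ℝ) : Prop where
  diff : DifferentiableAt ℝ f p
  val : f p = x
  fst : N.δ₁ w f p = d₁
  snd : N.δ₂ w f p = d₂

variable {N} {w w' : ℕ} {f g : ℝ × ℝ → ℝ} {p : ℝ × ℝ} {x y d₁ d₂ e₁ e₂ : ℝ}

theorem Jet.of_contDiffOn (w : ℕ) (hf : ContDiffOn ℝ ∞ f W.domain) (hp : p ∈ W.domain) :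
    N.Jet w f p (f p) (N.δ₁ w f p) (N.δ₂ w f p) :=
  ⟨PlanarWeb.differentiableAt_of_contDiffOn hf hp, rfl, rfl, rfl⟩

theorem Jet.add (hf : N.Jet w f p x d₁ d₂) (hg : N.Jet w g p y e₁ e₂) :
    N.Jet w (fun q => f q + g q) p (x + y) (d₁ + e₁) (d₂ + e₂) := by
  obtain ⟨hf, rfl, rfl, rfl⟩ := hf
  obtain ⟨hg, rfl, rfl, rfl⟩ := hg
  refine ⟨hf.add hg, rfl, ?_, ?_⟩ <;>
  · simp only [δ₁, δ₂, fderiv_fun_add hf hg, add_apply]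
    ring

theorem Jet.sub (hf : N.Jet w f p x d₁ d₂) (hg : N.Jet w g p y e₁ e₂) :
    N.Jet w (fun q => f q - g q) p (x - y) (d₁ - e₁) (d₂ - e₂) := by
  obtain ⟨hf, rfl, rfl, rfl⟩ := hf
  obtain ⟨hg, rfl, rfl, rfl⟩ := hg
  refine ⟨hf.sub hg, rfl, ?_, ?_⟩ <;>
  · simp only [δ₁, δ₂, fderiv_fun_sub hf hg, sub_apply]
    ring

theorem Jet.neg (hf : N.Jet w f p x d₁ d₂) : N.Jet w (fun q => -f q) p (-x) (-d₁) (-d₂) := by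
  obtain ⟨hf, rfl, rfl, rfl⟩ := hf
  refine ⟨hf.neg, rfl, ?_, ?_⟩ <;>
  · simp only [δ₁, δ₂, fderiv_fun_neg, neg_apply]
    ring

theorem Jet.mul (hf : N.Jet w f p x d₁ d₂) (hg : N.Jet w' g p y e₁ e₂) :
    N.Jet (w + w') (fun q => f q * g q) p (x * y) (d₁ * y + x * e₁) (d₂ * y + x * e₂) := by
  obtain ⟨hf, rfl, rfl, rfl⟩ := hf
  obtain ⟨hg, rfl, rfl, rfl⟩ := hg
  refine ⟨hf.mul hg, rfl, ?_, ?_⟩ <;>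
  · simp only [δ₁, δ₂, fderiv_fun_mul hf hg, add_apply, smul_apply, smul_eq_mul, Nat.cast_add]
    ring

theorem Jet.const (c : ℝ) : N.Jet 0 (fun _ => c) p c 0 0 :=
  ⟨differentiableAt_const c, rfl, by simp [δ₁], by simp [δ₂]⟩

theorem Jet.congr (hf : N.Jet w f p x d₁ d₂) (h : g =ᶠ[𝓝 p] f) : N.Jet w g p x d₁ d₂ :=
  ⟨hf.diff.congr_of_eventuallyEq h, h.self_of_nhds.trans hf.val,
    by rw [← hf.fst]; simp only [δ₁, h.fderiv_eq, h.self_of_nhds],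
    by rw [← hf.snd]; simp only [δ₂, h.fderiv_eq, h.self_of_nhds]⟩

theorem Jet.eq (hf : N.Jet w f p x d₁ d₂) (hg : N.Jet w g p y e₁ e₂) (h : f =ᶠ[𝓝 p] g) :
    x = y ∧ d₁ = e₁ ∧ d₂ = e₂ := by
  obtain ⟨hf, rfl, rfl, rfl⟩ := hf
  obtain ⟨hg, rfl, rfl, rfl⟩ := hg
  refine ⟨h.self_of_nhds, ?_, ?_⟩ <;>
  · simp only [δ₁, δ₂, h.fderiv_eq, h.self_of_nhds]

variable (N)

theorem δ₁_congr (h : f =ᶠ[𝓝 p] g) : N.δ₁ w f p = N.δ₁ w g p := by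
  simp only [δ₁, h.fderiv_eq, h.self_of_nhds]

theorem δ₂_congr (h : f =ᶠ[𝓝 p] g) : N.δ₂ w f p = N.δ₂ w g p := by
  simp only [δ₂, h.fderiv_eq, h.self_of_nhds]

/-! ### Differentials in the coframe -/

theorem eq_combination (hp : p ∈ W.domain) (α : ℝ × ℝ →L[ℝ] ℝ) :
    α = α (N.frame₁ p) • N.ω₁ p + α (N.frame₂ p) • N.ω₂ p := by
  have h := N.wedge_ne_zero hp
  have key : ∀ x y : ℝ, α (x, y) = x * α (1, 0) + y * α (0, 1) := by
    intro x y
    have : ((x, y) : ℝ × ℝ) = x • ((1, 0) : ℝ × ℝ) + y • ((0, 1) : ℝ × ℝ) := by simp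
    rw [this, map_add, map_smul, map_smul, smul_eq_mul, smul_eq_mul]
  apply oneForm_ext <;>
  · simp only [frame₁, frame₂, map_smul, smul_eq_mul, add_apply, smul_apply]
    rw [key (N.ω₂ p (0, 1)), key (-N.ω₁ p (0, 1))]
    field_simp
    simp only [wedge]
    ring

theorem hasFDerivAt_of_δ (hp : p ∈ W.domain) (hf : N.Jet w f p x d₁ d₂) :
    HasFDerivAt f (d₁ • N.ω₁ p + d₂ • N.ω₂ p + (w * x) • N.γ p) p := by
  obtain ⟨hf, rfl, rfl, rfl⟩ := hf
  refine hf.hasFDerivAt.congr_fderiv ?_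
  rw [N.eq_combination hp (fderiv ℝ f p)]
  apply oneForm_ext <;>
  · simp [δ₁, δ₂, γ]
    ring

theorem jet_of_hasFDerivAt (hp : p ∈ W.domain)
    (hf : HasFDerivAt f (d₁ • N.ω₁ p + d₂ • N.ω₂ p + (w * f p) • N.γ p) p) :
    N.Jet w f p (f p) d₁ d₂ := by
  obtain ⟨h1, h2, h3, h4⟩ := N.dual_frame hp
  refine ⟨hf.differentiableAt, rfl, ?_, ?_⟩
  · simp [δ₁, hf.fderiv, γ, h1, h2]
    ring
  · simp [δ₂, hf.fderiv, γ, h3, h4]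
    ring

/-- The structure equations absorb the derivatives of `ω₁, ω₂`: the coefficients of a 1-form behave
as functions of weight 1. -/
theorem extD_combination {b₁ b₂ : ℝ × ℝ → ℝ} (hp : p ∈ W.domain) (h₁ : DifferentiableAt ℝ b₁ p)
    (h₂ : DifferentiableAt ℝ b₂ p) : extD (fun q => b₁ q • N.ω₁ q + b₂ q • N.ω₂ q) p =
      (N.δ₁ 1 b₂ p - N.δ₂ 1 b₁ p) * wedge N.ω₁ N.ω₂ p := by
  have h := N.wedge_ne_zero hp
  have d1 := PlanarWeb.differentiableAt_of_contDiffOn N.smooth₁ hp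
  have d2 := PlanarWeb.differentiableAt_of_contDiffOn N.smooth₂ hp
  have e : extD (fun q => b₁ q • N.ω₁ q + b₂ q • N.ω₂ q) p =
      extD (fun q => b₁ q • N.ω₁ q) p + extD (fun q => b₂ q • N.ω₂ q) p :=
    extD_add (h₁.smul d1) (h₂.smul d2)
  have f1 : extD N.ω₁ p = N.g₂ p * wedge N.ω₁ N.ω₂ p := by rw [g₂, div_mul_cancel₀ _ h]
  have f2 : extD N.ω₂ p = -N.g₁ p * wedge N.ω₁ N.ω₂ p := by
    rw [g₁, neg_neg, div_mul_cancel₀ _ h]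
  rw [e, extD_smul h₁ d1, extD_smul h₂ d2, f1, f2,
    N.eq_combination hp (fderiv ℝ b₁ p), N.eq_combination hp (fderiv ℝ b₂ p)]
  simp only [δ₁, δ₂, add_apply, smul_apply, smul_eq_mul, wedge, Nat.cast_one]
  ring

theorem K_eq (hp : p ∈ W.domain) : N.K p = N.δ₁ 1 N.g₂ p - N.δ₂ 1 N.g₁ p := by
  have h := N.extD_combination hp (PlanarWeb.differentiableAt_of_contDiffOn N.contDiffOn_g₁ hp)
    (PlanarWeb.differentiableAt_of_contDiffOn N.contDiffOn_g₂ hp)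
  have h' : extD N.γ p = _ := h
  rw [K, h', mul_div_cancel_right₀ _ (N.wedge_ne_zero hp)]

/-- This is `d(df) = 0` in the coframe. -/
theorem δ_zero_comm (hf : ContDiffOn ℝ ∞ f W.domain) (hp : p ∈ W.domain) :
    N.δ₁ 1 (N.δ₂ 0 f) p = N.δ₂ 1 (N.δ₁ 0 f) p := by
  have h := N.extD_combination hp
    (PlanarWeb.differentiableAt_of_contDiffOn (N.contDiffOn_δ₁ 0 hf) hp)
    (PlanarWeb.differentiableAt_of_contDiffOn (N.contDiffOn_δ₂ 0 hf) hp)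
  have hev : (fun q => N.δ₁ 0 f q • N.ω₁ q + N.δ₂ 0 f q • N.ω₂ q) =ᶠ[𝓝 p] fderiv ℝ f := by
    filter_upwards [W.domain.isOpen.mem_nhds hp] with q hq
    rw [N.eq_combination hq (fderiv ℝ f q)]
    simp [δ₁, δ₂]
  rw [extD_congr hev] at h
  have hs : IsSymmSndFDerivAt ℝ f p :=
    (hf.contDiffAt (W.domain.isOpen.mem_nhds hp)).isSymmSndFDerivAt
      (by simpa using (WithTop.coe_le_coe.mpr le_top : ((2 : ℕ∞) : WithTop ℕ∞) ≤ ∞))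
  have h0 : extD (fderiv ℝ f) p = 0 := by
    rw [extD, hs.eq, sub_self]
  rw [h0] at h
  exact sub_eq_zero.mp ((mul_eq_zero.mp h.symm).resolve_right (N.wedge_ne_zero hp))

/-- On weight `w` the commutator is minus `w` times the curvature. Writing `δᵢ` on weight `w` as
`δᵢ` on weight 0 minus `w gᵢ` reduces it to `δ_zero_comm` and `K_eq`. -/
theorem δ_comm (w : ℕ) (hf : ContDiffOn ℝ ∞ f W.domain) (hp : p ∈ W.domain) :
    N.δ₁ (w + 1) (N.δ₂ w f) p = N.δ₂ (w + 1) (N.δ₁ w f) p - w * N.K p * f p := by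
  have h0 := N.δ_zero_comm hf hp
  have jf := Jet.of_contDiffOn (N := N) 0 hf hp
  have j1 := Jet.of_contDiffOn (N := N) 1 (N.contDiffOn_δ₁ 0 hf) hp
  have j2 := Jet.of_contDiffOn (N := N) 1 (N.contDiffOn_δ₂ 0 hf) hp
  have k1 := Jet.of_contDiffOn (N := N) 1 N.contDiffOn_g₁ hp
  have k2 := Jet.of_contDiffOn (N := N) 1 N.contDiffOn_g₂ hp
  have l1 := j1.sub ((Jet.const (w : ℝ)).mul (k1.mul jf))
  have l2 := j2.sub ((Jet.const (w : ℝ)).mul (k2.mul jf))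
  have e1 : N.δ₁ w f = fun q => N.δ₁ 0 f q - w * (N.g₁ q * f q) := by
    funext q; simp only [δ₁, Nat.cast_zero]; ring
  have e2 : N.δ₂ w f = fun q => N.δ₂ 0 f q - w * (N.g₂ q * f q) := by
    funext q; simp only [δ₂, Nat.cast_zero]; ring
  have s1 : ∀ h : ℝ × ℝ → ℝ, N.δ₁ (w + 1) h p = N.δ₁ 1 h p - w * N.g₁ p * h p := fun h => by
    simp only [δ₁, Nat.cast_add, Nat.cast_one]; ring
  have s2 : ∀ h : ℝ × ℝ → ℝ, N.δ₂ (w + 1) h p = N.δ₂ 1 h p - w * N.g₂ p * h p := fun h => by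
    simp only [δ₂, Nat.cast_add, Nat.cast_one]; ring
  have m1 := l1.snd
  have m2 := l2.fst
  rw [s1, s2, e1, e2, m1, m2, N.K_eq hp, h0]
  ring

/-- The exterior derivative of the right hand side of a linear equation for a function `f` of
weight `w`, at a point where the equation holds. -/
theorem extD_connection {b₁ b₂ : ℝ × ℝ → ℝ} (hp : p ∈ W.domain) (h₁ : DifferentiableAt ℝ b₁ p)
    (h₂ : DifferentiableAt ℝ b₂ p) (hf : N.Jet w f p (f p) (b₁ p) (b₂ p)) :
    extD (fun q => b₁ q • N.ω₁ q + b₂ q • N.ω₂ q + (w * f q) • N.γ q) p =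
      (N.δ₁ (w + 1) b₂ p - N.δ₂ (w + 1) b₁ p + w * N.K p * f p) * wedge N.ω₁ N.ω₂ p := by
  have e : (fun q => b₁ q • N.ω₁ q + b₂ q • N.ω₂ q + (w * f q) • N.γ q) = fun q =>
      (b₁ q + w * (N.g₁ q * f q)) • N.ω₁ q + (b₂ q + w * (N.g₂ q * f q)) • N.ω₂ q := by
    funext q
    apply oneForm_ext <;>
    · simp [γ]
      ring
  have jf : N.Jet 0 f p (f p) (b₁ p + w * N.g₁ p * f p) (b₂ p + w * N.g₂ p * f p) := by
    refine ⟨hf.diff, rfl, ?_, ?_⟩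
    · rw [← hf.fst]; simp [δ₁]
    · rw [← hf.snd]; simp [δ₂]
  have k1 := Jet.of_contDiffOn (N := N) 1 N.contDiffOn_g₁ hp
  have k2 := Jet.of_contDiffOn (N := N) 1 N.contDiffOn_g₂ hp
  have j1 : N.Jet 1 b₁ p _ _ _ := ⟨h₁, rfl, rfl, rfl⟩
  have j2 : N.Jet 1 b₂ p _ _ _ := ⟨h₂, rfl, rfl, rfl⟩
  have l1 := j1.add ((Jet.const (w : ℝ)).mul (k1.mul jf))
  have l2 := j2.add ((Jet.const (w : ℝ)).mul (k2.mul jf))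
  have s1 : N.δ₁ (w + 1) b₂ p = N.δ₁ 1 b₂ p - w * N.g₁ p * b₂ p := by
    simp only [δ₁, Nat.cast_add, Nat.cast_one]; ring
  have s2 : N.δ₂ (w + 1) b₁ p = N.δ₂ 1 b₁ p - w * N.g₂ p * b₁ p := by
    simp only [δ₂, Nat.cast_add, Nat.cast_one]; ring
  have m1 := l1.snd
  have m2 := l2.fst
  rw [e, N.extD_combination hp l1.diff l2.diff, m1, m2, s1, s2, N.K_eq hp]
  ring

end Normalization

theorem PlanarWeb.wedge_ne_zero_of_scale {d : ℕ} (W : PlanarWeb d) {i j : Fin d} (hij : i ≠ j)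
    {α β : OneForm} {p : ℝ × ℝ} (hp : p ∈ W.domain) (hα : ∃ s : ℝ, s ≠ 0 ∧ α p = s • W.form i p)
    (hβ : ∃ s : ℝ, s ≠ 0 ∧ β p = s • W.form j p) : wedge α β p ≠ 0 := by
  obtain ⟨s, hs, h1⟩ := hα
  obtain ⟨t, ht, h2⟩ := hβ
  have : wedge α β p = s * t * wedge (W.form i) (W.form j) p := by
    simp only [wedge, h1, h2, smul_apply, smul_eq_mul]
    ring
  rw [this]
  exact mul_ne_zero (mul_ne_zero hs ht) (W.transversal i j hij p hp)

namespace Normalization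

variable {W : PlanarWeb 4} (N : Normalization W) {p : ℝ × ℝ}

/-! ### The basic invariant -/

theorem ω₃_eq (hp : p ∈ W.domain) : N.ω₃ p = (-1 : ℝ) • N.ω₁ p + (-1 : ℝ) • N.ω₂ p := by
  have h := N.rel₃ p hp
  rw [← sub_eq_zero, ← h]
  module

theorem ω₄_eq (hp : p ∈ W.domain) : N.ω₄ p = (-N.a p) • N.ω₁ p + (-1 : ℝ) • N.ω₂ p := by
  have h := N.rel₄ p hp
  rw [← sub_eq_zero, ← h]
  module

theorem wedge_ω₄_ω₂ (hp : p ∈ W.domain) :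
    wedge N.ω₄ N.ω₂ p = -N.a p * wedge N.ω₁ N.ω₂ p := by
  simp only [wedge, N.ω₄_eq hp, add_apply, smul_apply, smul_eq_mul]
  ring

theorem a_ne_zero (hp : p ∈ W.domain) : N.a p ≠ 0 := by
  have h := W.wedge_ne_zero_of_scale (by decide) hp (N.scale₄ p hp) (N.scale₂ p hp)
  rw [N.wedge_ω₄_ω₂ hp] at h
  exact neg_ne_zero.mp (left_ne_zero_of_mul h)

theorem one_sub_a_ne_zero (hp : p ∈ W.domain) : 1 - N.a p ≠ 0 := by
  have h := W.wedge_ne_zero_of_scale (by decide) hp (N.scale₃ p hp) (N.scale₄ p hp)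
  have e : wedge N.ω₃ N.ω₄ p = (1 - N.a p) * wedge N.ω₁ N.ω₂ p := by
    simp only [wedge, N.ω₃_eq hp, N.ω₄_eq hp, add_apply, smul_apply, smul_eq_mul]
    ring
  rw [e] at h
  exact left_ne_zero_of_mul h

/-- A normalization only provides smooth forms; the basic invariant inherits smoothness as a
quotient of wedge products. -/
theorem contDiffOn_a : ContDiffOn ℝ ∞ N.a W.domain := by
  have h : ContDiffOn ℝ ∞ (fun q => -(wedge N.ω₄ N.ω₂ q / wedge N.ω₁ N.ω₂ q)) W.domain :=
    ((contDiffOn_wedge N.smooth₄ N.smooth₂).div (contDiffOn_wedge N.smooth₁ N.smooth₂)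
      fun q hq => N.wedge_ne_zero hq).neg
  refine h.congr fun q hq => ?_
  rw [N.wedge_ω₄_ω₂ hq, mul_div_cancel_right₀ _ (N.wedge_ne_zero hq), neg_neg]

theorem contDiffOn_a₁ : ContDiffOn ℝ ∞ N.a₁ W.domain := N.contDiffOn_δ₁ 0 N.contDiffOn_a

theorem contDiffOn_a₂ : ContDiffOn ℝ ∞ N.a₂ W.domain := N.contDiffOn_δ₂ 0 N.contDiffOn_a

theorem contDiffOn_a₁₁ : ContDiffOn ℝ ∞ N.a₁₁ W.domain := N.contDiffOn_δ₁ 1 N.contDiffOn_a₁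

theorem contDiffOn_a₁₂ : ContDiffOn ℝ ∞ N.a₁₂ W.domain := N.contDiffOn_δ₁ 1 N.contDiffOn_a₂

theorem contDiffOn_a₂₂ : ContDiffOn ℝ ∞ N.a₂₂ W.domain := N.contDiffOn_δ₂ 1 N.contDiffOn_a₂

theorem contDiffOn_a₁₁₂ : ContDiffOn ℝ ∞ N.a₁₁₂ W.domain :=
  (((N.contDiffOn_δ₁ 2 N.contDiffOn_a₁₂).add
    (N.contDiffOn_δ₁ 2 (N.contDiffOn_δ₂ 1 N.contDiffOn_a₁))).add
      (N.contDiffOn_δ₂ 2 N.contDiffOn_a₁₁)).div_const 3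

theorem contDiffOn_a₁₂₂ : ContDiffOn ℝ ∞ N.a₁₂₂ W.domain :=
  (((N.contDiffOn_δ₁ 2 N.contDiffOn_a₂₂).add (N.contDiffOn_δ₂ 2 N.contDiffOn_a₁₂)).add
    (N.contDiffOn_δ₂ 2 (N.contDiffOn_δ₂ 1 N.contDiffOn_a₁))).div_const 3

theorem contDiffOn_K₁ : ContDiffOn ℝ ∞ N.K₁ W.domain := N.contDiffOn_δ₁ 2 N.contDiffOn_K

theorem contDiffOn_K₂ : ContDiffOn ℝ ∞ N.K₂ W.domain := N.contDiffOn_δ₂ 2 N.contDiffOn_K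

theorem contDiffOn_c₀ : ContDiffOn ℝ ∞ N.c₀ W.domain := by
  have h0 := N.contDiffOn_a
  have h1 := N.contDiffOn_a₁
  have h2 := N.contDiffOn_a₂
  have h11 := N.contDiffOn_a₁₁
  have h12 := N.contDiffOn_a₁₂
  have h22 := N.contDiffOn_a₂₂
  have hK := N.contDiffOn_K
  have n0 : ∀ q ∈ W.domain, N.a q ≠ 0 := fun q => N.a_ne_zero
  have n1 : ∀ q ∈ W.domain, 1 - N.a q ≠ 0 := fun q => N.one_sub_a_ne_zero
  unfold c₀
  refine (hK.add (ContDiffOn.div (by fun_prop) (by fun_prop) fun q hq => ?_)).add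
    (ContDiffOn.div (by fun_prop) (by fun_prop) fun q hq => ?_)
  · simp [n0 q hq, n1 q hq]
  · simp [n0 q hq, n1 q hq]

theorem contDiffOn_c₁ : ContDiffOn ℝ ∞ N.c₁ W.domain := by
  have h0 := N.contDiffOn_a
  have h1 := N.contDiffOn_a₁
  have h2 := N.contDiffOn_a₂
  have h12 := N.contDiffOn_a₁₂
  have h22 := N.contDiffOn_a₂₂
  have h112 := N.contDiffOn_a₁₁₂
  have h122 := N.contDiffOn_a₁₂₂
  have hK := N.contDiffOn_K
  have hK1 := N.contDiffOn_K₁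
  have hK2 := N.contDiffOn_K₂
  have n0 : ∀ q ∈ W.domain, N.a q ≠ 0 := fun q => N.a_ne_zero
  have n1 : ∀ q ∈ W.domain, 1 - N.a q ≠ 0 := fun q => N.one_sub_a_ne_zero
  unfold c₁
  refine (((((ContDiffOn.div (by fun_prop) (by fun_prop) fun q hq => ?_).add
    ((ContDiffOn.div (by fun_prop) (by fun_prop) fun q hq => ?_).mul hK)).add
    (ContDiffOn.div (by fun_prop) (by fun_prop) fun q hq => ?_)).add
    ((ContDiffOn.div (by fun_prop) (by fun_prop) fun q hq => ?_).mul h22)).add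
    ((ContDiffOn.div (by fun_prop) (by fun_prop) fun q hq => ?_).mul h12)).sub
    (ContDiffOn.div (by fun_prop) (by fun_prop) fun q hq => ?_)
  all_goals simp [n0 q hq, n1 q hq]

theorem contDiffOn_c₂ : ContDiffOn ℝ ∞ N.c₂ W.domain := by
  have h0 := N.contDiffOn_a
  have h1 := N.contDiffOn_a₁
  have h2 := N.contDiffOn_a₂
  have hK := N.contDiffOn_K
  have hK1 := N.contDiffOn_K₁
  have hK2 := N.contDiffOn_K₂
  have n0 : ∀ q ∈ W.domain, N.a q ≠ 0 := fun q => N.a_ne_zero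
  have n1 : ∀ q ∈ W.domain, 1 - N.a q ≠ 0 := fun q => N.one_sub_a_ne_zero
  unfold c₂
  refine (ContDiffOn.div (by fun_prop) (by fun_prop) fun q hq => ?_).add
    ((ContDiffOn.div (by fun_prop) (by fun_prop) fun q hq => ?_).mul hK)
  all_goals simp [n0 q hq, n1 q hq]

theorem jet_a (hp : p ∈ W.domain) : N.Jet 0 N.a p (N.a p) (N.a₁ p) (N.a₂ p) :=
  .of_contDiffOn 0 N.contDiffOn_a hp

theorem δ₂_a₁ (hp : p ∈ W.domain) : N.δ₂ 1 N.a₁ p = N.a₁₂ p :=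
  (N.δ_zero_comm N.contDiffOn_a hp).symm

theorem jet_a₁ (hp : p ∈ W.domain) : N.Jet 1 N.a₁ p (N.a₁ p) (N.a₁₁ p) (N.a₁₂ p) :=
  N.δ₂_a₁ hp ▸ .of_contDiffOn 1 N.contDiffOn_a₁ hp

theorem jet_a₂ (hp : p ∈ W.domain) : N.Jet 1 N.a₂ p (N.a₂ p) (N.a₁₂ p) (N.a₂₂ p) :=
  .of_contDiffOn 1 N.contDiffOn_a₂ hp

/-- Two of the three terms symmetrized in `a₁₁₂` coincide, and the third differs from them by the
commutator `K a₁`; averaging leaves one third of it. -/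
theorem δ₁_a₁₂ (hp : p ∈ W.domain) : N.δ₁ 2 N.a₁₂ p = N.a₁₁₂ p - N.K p * N.a₁ p / 3 := by
  have h1 := N.δ_comm 1 N.contDiffOn_a₁ hp
  have h2 : N.δ₁ 2 (N.δ₂ 1 N.a₁) p = N.δ₁ 2 N.a₁₂ p := N.δ₁_congr <| by
    filter_upwards [W.domain.isOpen.mem_nhds hp] with q hq using N.δ₂_a₁ hq
  have h3 : N.a₁₁₂ p = (N.δ₁ 2 N.a₁₂ p + N.δ₁ 2 (N.δ₂ 1 N.a₁) p
    + N.δ₂ 2 (N.δ₁ 1 N.a₁) p) / 3 := rfl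
  norm_num at h1
  rw [h3, h2]
  rw [h2] at h1
  linarith

theorem δ₂_a₁₂ (hp : p ∈ W.domain) : N.δ₂ 2 N.a₁₂ p = N.a₁₂₂ p + N.K p * N.a₂ p / 3 := by
  have h1 := N.δ_comm 1 N.contDiffOn_a₂ hp
  have h2 : N.δ₂ 2 (N.δ₂ 1 N.a₁) p = N.δ₂ 2 N.a₁₂ p := N.δ₂_congr <| by
    filter_upwards [W.domain.isOpen.mem_nhds hp] with q hq using N.δ₂_a₁ hq
  have h3 : N.a₁₂₂ p = (N.δ₁ 2 (N.δ₂ 1 N.a₂) p + N.δ₂ 2 N.a₁₂ p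
    + N.δ₂ 2 (N.δ₂ 1 N.a₁) p) / 3 := rfl
  have h4 : N.δ₂ 2 N.a₁₂ p = N.δ₂ 2 (N.δ₁ 1 N.a₂) p := rfl
  norm_num at h1
  rw [h3, h2]
  linarith

theorem δ₁_a₂₂ (hp : p ∈ W.domain) : N.δ₁ 2 N.a₂₂ p = N.a₁₂₂ p - 2 * (N.K p * N.a₂ p) / 3 := by
  have h1 := N.δ_comm 1 N.contDiffOn_a₂ hp
  have h4 : N.δ₂ 2 (N.δ₁ 1 N.a₂) p = N.δ₂ 2 N.a₁₂ p := rfl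
  have h5 : N.δ₁ 2 (N.δ₂ 1 N.a₂) p = N.δ₁ 2 N.a₂₂ p := rfl
  norm_num at h1
  rw [← h5, h1, h4, N.δ₂_a₁₂ hp]
  ring

theorem jet_a₁₂ (hp : p ∈ W.domain) : N.Jet 2 N.a₁₂ p (N.a₁₂ p)
    (N.a₁₁₂ p - N.K p * N.a₁ p / 3) (N.a₁₂₂ p + N.K p * N.a₂ p / 3) :=
  N.δ₁_a₁₂ hp ▸ N.δ₂_a₁₂ hp ▸ .of_contDiffOn 2 N.contDiffOn_a₁₂ hp

theorem jet_a₂₂ (hp : p ∈ W.domain) : N.Jet 2 N.a₂₂ p (N.a₂₂ p)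
    (N.a₁₂₂ p - 2 * (N.K p * N.a₂ p) / 3) (N.δ₂ 2 N.a₂₂ p) :=
  N.δ₁_a₂₂ hp ▸ .of_contDiffOn 2 N.contDiffOn_a₂₂ hp

theorem jet_K (hp : p ∈ W.domain) : N.Jet 2 N.K p (N.K p) (N.K₁ p) (N.K₂ p) :=
  .of_contDiffOn 2 N.contDiffOn_K hp

/-! ### The prolonged abelian equation

The abelian equation is equivalent to a system for `u`, `v` and `s = δ₂ v`, of weights
`1`, `1`, `2`. -/

/-- The value of `δ₁ s` for solutions of the abelian equation. -/
def sFst (u v s : ℝ × ℝ → ℝ) (p : ℝ × ℝ) : ℝ :=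
  ((N.a₁ p + N.a p * N.a₂ p) * s p + (N.a₁₂ p + N.a₂ p * N.a₂ p - N.K p) * v p - N.K p * u p)
    / (1 - N.a p)

/-- The value of `δ₂ s` for solutions of the abelian equation. -/
def sSnd (u v s : ℝ × ℝ → ℝ) (p : ℝ × ℝ) : ℝ :=
  ((N.a₁ p + (3 * N.a p - 2) * N.a₂ p) * s p + (N.a p * N.a₂₂ p - N.a p * N.K p + N.a₁₂ p
    - N.a₂₂ p + N.a₂ p * N.a₂ p) * v p - N.K p * u p) / (N.a p * (1 - N.a p))

/-- The value of `δ₁ v` for solutions of the abelian equation; it is also the value of `-δ₁ u`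
and of `-δ₂ u`. -/
def vFst (v s : ℝ × ℝ → ℝ) (p : ℝ × ℝ) : ℝ := N.a p * s p + N.a₂ p * v p

/-- The equations for `u` and `v` at a point. -/
structure AbelianAt (u v s : ℝ × ℝ → ℝ) (p : ℝ × ℝ) : Prop where
  jet_u : N.Jet 1 u p (u p) (-N.vFst v s p) (-N.vFst v s p)
  jet_v : N.Jet 1 v p (v p) (N.vFst v s p) (s p)

/-- The equations for `u`, `v` and `s` at a point. -/
structure ProlongedAt (u v s : ℝ × ℝ → ℝ) (p : ℝ × ℝ) : Prop extends N.AbelianAt u v s p where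
  jet_s : N.Jet 2 s p (s p) (N.sFst u v s p) (N.sSnd u v s p)

variable {u v s : ℝ × ℝ → ℝ}

theorem contDiffOn_sFst (hu : ContDiffOn ℝ ∞ u W.domain) (hv : ContDiffOn ℝ ∞ v W.domain)
    (hs : ContDiffOn ℝ ∞ s W.domain) : ContDiffOn ℝ ∞ (N.sFst u v s) W.domain := by
  have h0 := N.contDiffOn_a
  have h1 := N.contDiffOn_a₁
  have h2 := N.contDiffOn_a₂
  have h12 := N.contDiffOn_a₁₂
  have hK := N.contDiffOn_K
  unfold sFst
  exact ContDiffOn.div (by fun_prop) (by fun_prop) fun q hq => N.one_sub_a_ne_zero hq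

theorem contDiffOn_sSnd (hu : ContDiffOn ℝ ∞ u W.domain) (hv : ContDiffOn ℝ ∞ v W.domain)
    (hs : ContDiffOn ℝ ∞ s W.domain) : ContDiffOn ℝ ∞ (N.sSnd u v s) W.domain := by
  have h0 := N.contDiffOn_a
  have h1 := N.contDiffOn_a₁
  have h2 := N.contDiffOn_a₂
  have h12 := N.contDiffOn_a₁₂
  have h22 := N.contDiffOn_a₂₂
  have hK := N.contDiffOn_K
  unfold sSnd
  exact ContDiffOn.div (by fun_prop) (by fun_prop) fun q hq =>
    mul_ne_zero (N.a_ne_zero hq) (N.one_sub_a_ne_zero hq)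

variable {N} {σ₁ σ₂ : ℝ}

theorem AbelianAt.jet_vFst (hp : p ∈ W.domain) (h : N.AbelianAt u v s p)
    (hs : N.Jet 2 s p (s p) σ₁ σ₂) : N.Jet 2 (N.vFst v s) p (N.vFst v s p)
      (N.a₁ p * s p + N.a p * σ₁ + (N.a₁₂ p * v p + N.a₂ p * N.vFst v s p))
      (N.a₂ p * s p + N.a p * σ₂ + (N.a₂₂ p * v p + N.a₂ p * s p)) :=
  ((N.jet_a hp).mul hs).add ((N.jet_a₂ hp).mul h.jet_v)

/-- The integrability conditions of the equations for `u` and `v` determine the derivatives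
of `s`. -/
theorem compat_iff (hp : p ∈ W.domain) (h : N.AbelianAt u v s p)
    (hs : N.Jet 2 s p (s p) σ₁ σ₂) :
    (N.δ₁ 2 (fun q => -N.vFst v s q) p - N.δ₂ 2 (fun q => -N.vFst v s q) p + N.K p * u p = 0 ∧
      N.δ₁ 2 s p - N.δ₂ 2 (N.vFst v s) p + N.K p * v p = 0) ↔
    σ₁ = N.sFst u v s p ∧ σ₂ = N.sSnd u v s p := by
  have j := h.jet_vFst hp hs
  have n0 := N.a_ne_zero hp
  have n1 := N.one_sub_a_ne_zero hp
  rw [j.neg.fst, j.neg.snd, j.snd, hs.fst, sFst, sSnd, eq_div_iff n1,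
    eq_div_iff (mul_ne_zero n0 n1), vFst]
  -- The two conditions are linear in `σ₁, σ₂` with determinant `-a (1 - a)`. Their sum isolates
  -- `σ₁`; the first plus `a` times the second isolates `σ₂`.
  constructor
  · rintro ⟨e1, e2⟩
    constructor
    · linear_combination e1 + e2
    · linear_combination e1 + N.a p * e2
  · rintro ⟨e1, e2⟩
    constructor
    · apply mul_left_cancel₀ n1
      linear_combination e2 - N.a p * e1
    · apply mul_left_cancel₀ n1
      linear_combination e1 - e2

/-- The integrability condition of the equation for `s`. -/
theorem ProlongedAt.compat (hp : p ∈ W.domain) (hu : ContDiffOn ℝ ∞ u W.domain)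
    (hv : ContDiffOn ℝ ∞ v W.domain) (hs : ContDiffOn ℝ ∞ s W.domain)
    (h : N.ProlongedAt u v s p) :
    N.δ₁ 3 (N.sSnd u v s) p - N.δ₂ 3 (N.sFst u v s) p + 2 * N.K p * s p =
      4 * (N.c₀ p * s p + N.c₁ p * v p + N.c₂ p * u p) := by
  have n0 := N.a_ne_zero hp
  have n1 := N.one_sub_a_ne_zero hp
  have jT1 := Jet.of_contDiffOn (N := N) 3 (N.contDiffOn_sFst hu hv hs) hp
  have jT2 := Jet.of_contDiffOn (N := N) 3 (N.contDiffOn_sSnd hu hv hs) hp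
  have ja := N.jet_a hp
  have j1 := N.jet_a₁ hp
  have j2 := N.jet_a₂ hp
  have j12 := N.jet_a₁₂ hp
  have j22 := N.jet_a₂₂ hp
  have jK := N.jet_K hp
  have ju := h.jet_u
  have jv := h.jet_v
  have js := h.jet_s
  have hD := W.domain.isOpen.mem_nhds hp
  -- Denominators are cleared before differentiating, so that the product rule alone gives the
  -- derivatives of `sFst` and `sSnd`. Only `δ₂` of the first and `δ₁` of the second are needed,
  -- hence no pure third derivative of `a` enters.
  have eq1 := (((Jet.const 1).sub ja).mul jT1).eq
    ((((j1.add (ja.mul j2)).mul js).add (((j12.add (j2.mul j2)).sub jK).mul jv)).sub (jK.mul ju))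
    (by
      filter_upwards [hD] with q hq
      exact mul_div_cancel₀ _ (N.one_sub_a_ne_zero hq))
  have eq2 := ((ja.mul ((Jet.const 1).sub ja)).mul jT2).eq
    ((((j1.add ((((Jet.const 3).mul ja).sub (Jet.const 2)).mul j2)).mul js).add
      ((((((ja.mul j22).sub (ja.mul jK)).add j12).sub j22).add (j2.mul j2)).mul jv)).sub
        (jK.mul ju))
    (by
      filter_upwards [hD] with q hq
      exact mul_div_cancel₀ _ (mul_ne_zero (N.a_ne_zero hq) (N.one_sub_a_ne_zero hq)))
  obtain ⟨v1, -, w1⟩ := eq1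
  obtain ⟨v2, w2, -⟩ := eq2
  simp only [vFst] at v1 v2 w1 w2
  simp only [c₀, c₁, c₂]
  generalize N.sFst u v s p = T₁ at *
  generalize N.sSnd u v s p = T₂ at *
  generalize N.δ₁ 3 (N.sSnd u v s) p = X at *
  generalize N.δ₂ 3 (N.sFst u v s) p = Y at *
  generalize N.a p = a at *
  generalize N.a₁ p = a₁ at *
  generalize N.a₂ p = a₂ at *
  generalize N.a₁₁ p = a₁₁ at *
  generalize N.a₁₂ p = a₁₂ at *
  generalize N.a₂₂ p = a₂₂ at *
  generalize N.a₁₁₂ p = a₁₁₂ at *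
  generalize N.a₁₂₂ p = a₁₂₂ at *
  generalize N.K p = K at *
  generalize N.K₁ p = K₁ at *
  generalize N.K₂ p = K₂ at *
  generalize s p = z at *
  generalize u p = x at *
  generalize v p = y at *
  clear ja j1 j2 j12 j22 jK ju jv js jT1 jT2
  have hX : X = (a * (1 - a) * X) / (a * (1 - a)) := by field_simp
  have hY : Y = ((1 - a) * Y) / (1 - a) := by field_simp
  have hT₁ : T₁ = ((1 - a) * T₁) / (1 - a) := by field_simp
  have hT₂ : T₂ = (a * (1 - a) * T₂) / (a * (1 - a)) := by field_simp
  rw [v1] at hT₁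
  rw [v2] at hT₂
  rw [← eq_sub_iff_add_eq'] at w1 w2
  rw [w1] at hY
  rw [w2] at hX
  rw [hX, hY, hT₁, hT₂]
  field_simp
  ring

end Normalization

namespace Normalization

variable {W : PlanarWeb 4} (N : Normalization W) {p : ℝ × ℝ}

/-! ### Linear systems for weighted functions -/

section LinearSystem

variable {n : ℕ}

/-- The functions `X j` of weights `w j` satisfy `δ₁ X = B₁ X` and `δ₂ X = B₂ X` at `p`. -/
def SystemAt (w : Fin n → ℕ) (B₁ B₂ : ℝ × ℝ → Matrix (Fin n) (Fin n) ℝ)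
    (X : Fin n → ℝ × ℝ → ℝ) (p : ℝ × ℝ) : Prop :=
  ∀ j, N.Jet (w j) (X j) p (X j p) (∑ k, B₁ p j k * X k p) (∑ k, B₂ p j k * X k p)

/-- The matrix of `1`-forms of a linear system for weighted functions. -/
def systemForm (w : Fin n → ℕ) (B₁ B₂ : ℝ × ℝ → Matrix (Fin n) (Fin n) ℝ) (j k : Fin n) :
    OneForm := fun q =>
  B₁ q j k • N.ω₁ q + B₂ q j k • N.ω₂ q + (if j = k then (w j : ℝ) else 0) • N.γ q

variable {w : Fin n → ℕ} {B₁ B₂ : ℝ × ℝ → Matrix (Fin n) (Fin n) ℝ} {X : Fin n → ℝ × ℝ → ℝ}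

theorem sum_systemForm (j : Fin n) (q : ℝ × ℝ) : ∑ k, X k q • N.systemForm w B₁ B₂ j k q =
    (∑ k, B₁ q j k * X k q) • N.ω₁ q + (∑ k, B₂ q j k * X k q) • N.ω₂ q
      + (w j * X j q) • N.γ q := by
  simp only [systemForm, smul_add, Finset.sum_add_distrib, smul_smul, ← Finset.sum_smul, mul_comm]
  simp

theorem systemAt_iff (hp : p ∈ W.domain) : N.SystemAt w B₁ B₂ X p ↔
    ∀ j, HasFDerivAt (X j) (∑ k, X k p • N.systemForm w B₁ B₂ j k p) p := by
  simp only [sum_systemForm]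
  exact ⟨fun h j => N.hasFDerivAt_of_δ hp (h j), fun h j => N.jet_of_hasFDerivAt hp (h j)⟩

theorem contDiffOn_systemForm (h₁ : ∀ j k, ContDiffOn ℝ ∞ (fun q => B₁ q j k) W.domain)
    (h₂ : ∀ j k, ContDiffOn ℝ ∞ (fun q => B₂ q j k) W.domain) (j k : Fin n) :
    ContDiffOn ℝ ∞ (N.systemForm w B₁ B₂ j k) W.domain :=
  (((h₁ j k).smul N.smooth₁).add ((h₂ j k).smul N.smooth₂)).add (N.contDiffOn_γ.const_smul _)

/-- By `extD_connection`, flatness of the matrix of 1-forms is the commutator identity for each row,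
needed only at a point where the test functions satisfy the system. -/
theorem exists_systemAt (hD : SimplyConnectedSpace W.domain)
    (h₁ : ∀ j k, ContDiffOn ℝ ∞ (fun q => B₁ q j k) W.domain)
    (h₂ : ∀ j k, ContDiffOn ℝ ∞ (fun q => B₂ q j k) W.domain)
    (hflat : ∀ p ∈ W.domain, ∀ X : Fin n → ℝ × ℝ → ℝ, (∀ j, ContDiffOn ℝ ∞ (X j) W.domain) →
      N.SystemAt w B₁ B₂ X p → ∀ j, N.δ₁ (w j + 1) (fun q => ∑ k, B₂ q j k * X k q) p
        - N.δ₂ (w j + 1) (fun q => ∑ k, B₁ q j k * X k q) p + w j * N.K p * X j p = 0)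
    {p₀ : ℝ × ℝ} (hp₀ : p₀ ∈ W.domain) (x₀ : Fin n → ℝ) :
    ∃ X : Fin n → ℝ × ℝ → ℝ, (∀ j, ContDiffOn ℝ ∞ (X j) W.domain) ∧ (∀ j, X j p₀ = x₀ j) ∧
      ∀ p ∈ W.domain, N.SystemAt w B₁ B₂ X p := by
  have : SimplyConnectedSpace (W.domain : Set (ℝ × ℝ)) := hD
  have ex := exists_solution_of_flat W.domain.isOpen
    (N.contDiffOn_systemForm (w := w) h₁ h₂) ?_ hp₀ x₀
  · obtain ⟨X, hX, hX0, hXd⟩ := ex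
    exact ⟨X, hX, hX0, fun p hp => (N.systemAt_iff hp).mpr (hXd p hp)⟩
  intro p hp X hX hXd j
  have hS := (N.systemAt_iff hp).mpr hXd
  simp only [sum_systemForm]
  have hsum : ∀ {B : ℝ × ℝ → Matrix (Fin n) (Fin n) ℝ},
      (∀ j k, ContDiffOn ℝ ∞ (fun q => B q j k) W.domain) →
      DifferentiableAt ℝ (fun q => ∑ k, B q j k * X k q) p := fun hB =>
    PlanarWeb.differentiableAt_of_contDiffOn
      (ContDiffOn.sum fun k _ => (hB j k).mul (hX k).contDiffOn) hp
  rw [N.extD_connection hp (hsum h₁) (hsum h₂) (hS j),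
    hflat p hp X (fun k => (hX k).contDiffOn) hS j, zero_mul]

theorem SystemAt.eq_zero (hD : SimplyConnectedSpace W.domain)
    (h₁ : ∀ j k, ContDiffOn ℝ ∞ (fun q => B₁ q j k) W.domain)
    (h₂ : ∀ j k, ContDiffOn ℝ ∞ (fun q => B₂ q j k) W.domain)
    (hX : ∀ p ∈ W.domain, N.SystemAt w B₁ B₂ X p) {p₀ : ℝ × ℝ} (hp₀ : p₀ ∈ W.domain)
    (h0 : ∀ j, X j p₀ = 0) : ∀ p ∈ W.domain, ∀ j, X j p = 0 :=
  eqOn_zero_of_solution W.domain.isOpen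
    (isPreconnected_iff_preconnectedSpace.mpr (inferInstanceAs (PreconnectedSpace W.domain)))
    (N.contDiffOn_systemForm (w := w) h₁ h₂)
    (fun q hq => (N.systemAt_iff hq).mp (hX q hq)) hp₀ h0

end LinearSystem

/-! ### The derivatives of the obstruction -/

/-- The coefficient of `s` in `δ₁ (c₀ s + c₁ v + c₂ u)`. -/
def dS₁ (p : ℝ × ℝ) : ℝ := N.c₀₁ p + N.c₀ p * ((N.a₁ p + N.a p * N.a₂ p) / (1 - N.a p))
  + N.c₁ p * N.a p - N.c₂ p * N.a p

/-- The coefficient of `v` in `δ₁ (c₀ s + c₁ v + c₂ u)`. -/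
def dV₁ (p : ℝ × ℝ) : ℝ := N.c₁₁ p
  + N.c₀ p * ((N.a₁₂ p + N.a₂ p * N.a₂ p - N.K p) / (1 - N.a p))
  + N.c₁ p * N.a₂ p - N.c₂ p * N.a₂ p

/-- The coefficient of `u` in `δ₁ (c₀ s + c₁ v + c₂ u)`. -/
def dU₁ (p : ℝ × ℝ) : ℝ := N.c₂₁ p - N.c₀ p * (N.K p / (1 - N.a p))

/-- The coefficient of `s` in `δ₂ (c₀ s + c₁ v + c₂ u)`. -/
def dS₂ (p : ℝ × ℝ) : ℝ := N.c₀₂ p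
  + N.c₀ p * ((N.a₁ p + (3 * N.a p - 2) * N.a₂ p) / (N.a p * (1 - N.a p)))
  + N.c₁ p - N.c₂ p * N.a p

/-- The coefficient of `v` in `δ₂ (c₀ s + c₁ v + c₂ u)`. -/
def dV₂ (p : ℝ × ℝ) : ℝ := N.c₁₂ p + N.c₀ p * ((N.a p * N.a₂₂ p - N.a p * N.K p + N.a₁₂ p
    - N.a₂₂ p + N.a₂ p * N.a₂ p) / (N.a p * (1 - N.a p))) - N.c₂ p * N.a₂ p

/-- The coefficient of `u` in `δ₂ (c₀ s + c₁ v + c₂ u)`. -/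
def dU₂ (p : ℝ × ℝ) : ℝ := N.c₂₂ p - N.c₀ p * (N.K p / (N.a p * (1 - N.a p)))

variable {N} {u v s : ℝ × ℝ → ℝ} {σ₁ σ₂ : ℝ}

/-- The coefficients on the left use the prolonged values of `δ₁ s, δ₂ s`, so the right-hand sides
measure how far `s` is from satisfying its equation. For prolonged solutions they are zero; for the
reduced system, vanishing of the left-hand sides forces the equation for `s`. -/
theorem AbelianAt.derivative_obstruction (hp : p ∈ W.domain) (h : N.AbelianAt u v s p)
    (hs : N.Jet 2 s p (s p) σ₁ σ₂)
    (hc : ∀ q ∈ W.domain, N.c₀ q * s q + N.c₁ q * v q + N.c₂ q * u q = 0) :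
    N.dS₁ p * s p + N.dV₁ p * v p + N.dU₁ p * u p = N.c₀ p * (N.sFst u v s p - σ₁) ∧
    N.dS₂ p * s p + N.dV₂ p * v p + N.dU₂ p * u p = N.c₀ p * (N.sSnd u v s p - σ₂) := by
  have j0 : N.Jet 2 N.c₀ p (N.c₀ p) (N.c₀₁ p) (N.c₀₂ p) := .of_contDiffOn 2 N.contDiffOn_c₀ hp
  have j1 : N.Jet 3 N.c₁ p (N.c₁ p) (N.c₁₁ p) (N.c₁₂ p) := .of_contDiffOn 3 N.contDiffOn_c₁ hp
  have j2 : N.Jet 3 N.c₂ p (N.c₂ p) (N.c₂₁ p) (N.c₂₂ p) := .of_contDiffOn 3 N.contDiffOn_c₂ hp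
  have j := ((j0.mul hs).add (j1.mul h.jet_v)).add (j2.mul h.jet_u)
  have z : N.Jet 4 (fun _ => 0) p 0 0 0 :=
    ⟨differentiableAt_const _, rfl, by simp [δ₁], by simp [δ₂]⟩
  obtain ⟨-, e1, e2⟩ := j.eq z
    (by filter_upwards [W.domain.isOpen.mem_nhds hp] with q hq using hc q hq)
  have n0 := N.a_ne_zero hp
  have n1 := N.one_sub_a_ne_zero hp
  rw [vFst] at e1 e2
  constructor
  · rw [dS₁, dV₁, dU₁, sFst]
    linear_combination e1
  · rw [dS₂, dV₂, dU₂, sSnd]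
    linear_combination e2

/-- For each of the two types of minor, with `m₁, m₂` coming from `δ₁, δ₂`, the `Gᵢⱼ` are `a (m₂ -
m₁)` and `m₁ - a m₂`; this substitution is invertible because `a ≠ 0, 1`. -/
theorem G_eq_zero_iff (hp : p ∈ W.domain) :
    (N.G₁₁ p = 0 ∧ N.G₁₂ p = 0 ∧ N.G₂₁ p = 0 ∧ N.G₂₂ p = 0) ↔
      (N.c₀ p * N.dV₁ p - N.c₁ p * N.dS₁ p = 0 ∧ N.c₀ p * N.dV₂ p - N.c₁ p * N.dS₂ p = 0) ∧
      (N.c₀ p * N.dU₁ p - N.c₂ p * N.dS₁ p = 0 ∧ N.c₀ p * N.dU₂ p - N.c₂ p * N.dS₂ p = 0) := by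
  have n0 := N.a_ne_zero hp
  have n1 := N.one_sub_a_ne_zero hp
  have h11 : N.G₁₁ p = N.a p * ((N.c₀ p * N.dU₂ p - N.c₂ p * N.dS₂ p)
      - (N.c₀ p * N.dU₁ p - N.c₂ p * N.dS₁ p)) := by
    simp only [G₁₁, dU₁, dU₂, dS₁, dS₂]
    field_simp
    ring
  have h12 : N.G₁₂ p = N.a p * ((N.c₀ p * N.dV₂ p - N.c₁ p * N.dS₂ p)
      - (N.c₀ p * N.dV₁ p - N.c₁ p * N.dS₁ p)) := by
    simp only [G₁₂, dV₁, dV₂, dS₁, dS₂]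
    field_simp
    ring
  have h21 : N.G₂₁ p = (N.c₀ p * N.dU₁ p - N.c₂ p * N.dS₁ p)
      - N.a p * (N.c₀ p * N.dU₂ p - N.c₂ p * N.dS₂ p) := by
    simp only [G₂₁, dU₁, dU₂, dS₁, dS₂]
    field_simp
    ring
  have h22 : N.G₂₂ p = (N.c₀ p * N.dV₁ p - N.c₁ p * N.dS₁ p)
      - N.a p * (N.c₀ p * N.dV₂ p - N.c₁ p * N.dS₂ p) := by
    simp only [G₂₂, dV₁, dV₂, dS₁, dS₂]
    field_simp
    ring
  rw [h11, h12, h21, h22]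
  constructor
  · rintro ⟨e11, e12, e21, e22⟩
    have k1 : (1 - N.a p) * (N.c₀ p * N.dV₁ p - N.c₁ p * N.dS₁ p) = 0 := by
      linear_combination e12 + e22
    have k2 : (1 - N.a p) * (N.c₀ p * N.dU₁ p - N.c₂ p * N.dS₁ p) = 0 := by
      linear_combination e11 + e21
    have l1 := (mul_eq_zero.mp k1).resolve_left n1
    have l2 := (mul_eq_zero.mp k2).resolve_left n1
    rw [l1, sub_zero] at e12
    rw [l2, sub_zero] at e11
    exact ⟨⟨l1, (mul_eq_zero.mp e12).resolve_left n0⟩,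
      l2, (mul_eq_zero.mp e11).resolve_left n0⟩
  · rintro ⟨⟨e1, e2⟩, e3, e4⟩
    rw [e1, e2, e3, e4]
    simp

variable (N)

/-! ### The prolonged system and the reduced system -/

/-- The coefficients of `δ₁ (u, v, s)`. -/
def prolongedFst (q : ℝ × ℝ) : Matrix (Fin 3) (Fin 3) ℝ :=
  !![0, -N.a₂ q, -N.a q; 0, N.a₂ q, N.a q;
    -(N.K q / (1 - N.a q)), (N.a₁₂ q + N.a₂ q * N.a₂ q - N.K q) / (1 - N.a q),
      (N.a₁ q + N.a q * N.a₂ q) / (1 - N.a q)]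

/-- The coefficients of `δ₂ (u, v, s)`. -/
def prolongedSnd (q : ℝ × ℝ) : Matrix (Fin 3) (Fin 3) ℝ :=
  !![0, -N.a₂ q, -N.a q; 0, 0, 1;
    -(N.K q / (N.a q * (1 - N.a q))),
      (N.a q * N.a₂₂ q - N.a q * N.K q + N.a₁₂ q - N.a₂₂ q + N.a₂ q * N.a₂ q)
        / (N.a q * (1 - N.a q)),
      (N.a₁ q + (3 * N.a q - 2) * N.a₂ q) / (N.a q * (1 - N.a q))]

theorem contDiffOn_prolongedFst (j k : Fin 3) :
    ContDiffOn ℝ ∞ (fun q => N.prolongedFst q j k) W.domain := by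
  have h0 := N.contDiffOn_a
  have h1 := N.contDiffOn_a₁
  have h2 := N.contDiffOn_a₂
  have h12 := N.contDiffOn_a₁₂
  have hK := N.contDiffOn_K
  have hd : ContDiffOn ℝ ∞ (fun q => (1 - N.a q)⁻¹) W.domain :=
    (contDiffOn_const.sub h0).inv fun q hq => N.one_sub_a_ne_zero hq
  fin_cases j <;> fin_cases k <;> simp [prolongedFst, div_eq_mul_inv] <;> fun_prop

theorem contDiffOn_prolongedSnd (j k : Fin 3) :
    ContDiffOn ℝ ∞ (fun q => N.prolongedSnd q j k) W.domain := by
  have h0 := N.contDiffOn_a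
  have h1 := N.contDiffOn_a₁
  have h2 := N.contDiffOn_a₂
  have h12 := N.contDiffOn_a₁₂
  have h22 := N.contDiffOn_a₂₂
  have hK := N.contDiffOn_K
  have hd : ContDiffOn ℝ ∞ (fun q => (N.a q * (1 - N.a q))⁻¹) W.domain :=
    (h0.mul (contDiffOn_const.sub h0)).inv fun q hq =>
      mul_ne_zero (N.a_ne_zero hq) (N.one_sub_a_ne_zero hq)
  fin_cases j <;> fin_cases k <;> simp [prolongedSnd, div_eq_mul_inv, -mul_inv_rev] <;>
    fun_prop

theorem sum_prolonged (X : Fin 3 → ℝ × ℝ → ℝ) (q : ℝ × ℝ) :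
    (∑ k, N.prolongedFst q 0 k * X k q = -N.vFst (X 1) (X 2) q ∧
      ∑ k, N.prolongedSnd q 0 k * X k q = -N.vFst (X 1) (X 2) q) ∧
    (∑ k, N.prolongedFst q 1 k * X k q = N.vFst (X 1) (X 2) q ∧
      ∑ k, N.prolongedSnd q 1 k * X k q = X 2 q) ∧
    (∑ k, N.prolongedFst q 2 k * X k q = N.sFst (X 0) (X 1) (X 2) q ∧
      ∑ k, N.prolongedSnd q 2 k * X k q = N.sSnd (X 0) (X 1) (X 2) q) := by
  refine ⟨⟨?_, ?_⟩, ⟨?_, ?_⟩, ?_, ?_⟩ <;>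
  · simp [Fin.sum_univ_three, prolongedFst, prolongedSnd, vFst, sFst, sSnd]
    try ring

theorem systemAt_prolonged_iff (X : Fin 3 → ℝ × ℝ → ℝ) :
    N.SystemAt ![1, 1, 2] N.prolongedFst N.prolongedSnd X p ↔
      N.ProlongedAt (X 0) (X 1) (X 2) p := by
  obtain ⟨⟨e1, e2⟩, ⟨e3, e4⟩, e5, e6⟩ := N.sum_prolonged X p
  simp only [SystemAt, Fin.forall_fin_succ, Fin.succ_zero_eq_one, Fin.succ_one_eq_two, e1, e2, e3,
    e4, e5, e6]
  constructor
  · rintro ⟨h1, h2, h3, -⟩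
    exact ⟨⟨h1, h2⟩, h3⟩
  · rintro ⟨⟨h1, h2⟩, h3⟩
    exact ⟨h1, h2, h3, fun i => i.elim0⟩

/-- With no obstruction the prolonged system is flat: `compat_iff` handles the rows of `u` and `v`,
and `ProlongedAt.compat` that of `s`. -/
theorem exists_prolonged (hD : SimplyConnectedSpace W.domain)
    (hc : ∀ q ∈ W.domain, N.c₀ q = 0 ∧ N.c₁ q = 0 ∧ N.c₂ q = 0) {p₀ : ℝ × ℝ}
    (hp₀ : p₀ ∈ W.domain) (x y z : ℝ) :
    ∃ u v s : ℝ × ℝ → ℝ, ContDiffOn ℝ ∞ u W.domain ∧ ContDiffOn ℝ ∞ v W.domain ∧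
      (u p₀ = x ∧ v p₀ = y ∧ s p₀ = z) ∧ ∀ q ∈ W.domain, N.AbelianAt u v s q := by
  have ex := N.exists_systemAt (w := ![1, 1, 2]) hD N.contDiffOn_prolongedFst
    N.contDiffOn_prolongedSnd ?_ hp₀ ![x, y, z]
  · obtain ⟨X, hX, hX0, hXs⟩ := ex
    exact ⟨X 0, X 1, X 2, hX 0, hX 1, ⟨hX0 0, hX0 1, hX0 2⟩,
      fun q hq => ((N.systemAt_prolonged_iff X).mp (hXs q hq)).toAbelianAt⟩
  intro p hp X hX hS
  have hP := (N.systemAt_prolonged_iff X).mp hS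
  obtain ⟨k1, k2⟩ := (compat_iff hp hP.toAbelianAt hP.jet_s).mpr ⟨rfl, rfl⟩
  have k3 := hP.compat hp (hX 0) (hX 1) (hX 2)
  obtain ⟨c0, c1, c2⟩ := hc p hp
  rw [c0, c1, c2] at k3
  rw [Fin.forall_fin_succ, Fin.forall_fin_succ, Fin.forall_fin_succ]
  simp only [Fin.succ_zero_eq_one, Fin.succ_one_eq_two, N.sum_prolonged X]
  refine ⟨?_, ?_, ?_, fun i => i.elim0⟩
  · simpa using k1
  · simpa using k2
  · simpa using k3

/-- Uniqueness requires no flatness, so an abelian relation is always determined by `(u, v, s)` at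
one point. -/
theorem ProlongedAt.eq_zero (hD : SimplyConnectedSpace W.domain)
    (h : ∀ q ∈ W.domain, N.ProlongedAt u v s q) {p₀ : ℝ × ℝ} (hp₀ : p₀ ∈ W.domain)
    (hu : u p₀ = 0) (hv : v p₀ = 0) (hs : s p₀ = 0) : ∀ q ∈ W.domain, u q = 0 ∧ v q = 0 := by
  have := SystemAt.eq_zero N (X := ![u, v, s]) (w := ![1, 1, 2]) hD N.contDiffOn_prolongedFst
    N.contDiffOn_prolongedSnd (fun q hq => (N.systemAt_prolonged_iff _).mpr (h q hq)) hp₀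
    (by simp [Fin.forall_fin_succ, hu, hv, hs])
  exact fun q hq => ⟨this q hq 0, this q hq 1⟩

/-- The value of `s` determined by `u` and `v` where the obstruction vanishes. -/
def reducedS (u v : ℝ × ℝ → ℝ) (q : ℝ × ℝ) : ℝ := -(N.c₁ q * v q + N.c₂ q * u q) / N.c₀ q

/-- The coefficients of `δ₁ (u, v)` for the reduced system. -/
def reducedFst (q : ℝ × ℝ) : Matrix (Fin 2) (Fin 2) ℝ :=
  !![N.a q * N.c₂ q / N.c₀ q, N.a q * N.c₁ q / N.c₀ q - N.a₂ q;
    -(N.a q * N.c₂ q / N.c₀ q), N.a₂ q - N.a q * N.c₁ q / N.c₀ q]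

/-- The coefficients of `δ₂ (u, v)` for the reduced system. -/
def reducedSnd (q : ℝ × ℝ) : Matrix (Fin 2) (Fin 2) ℝ :=
  !![N.a q * N.c₂ q / N.c₀ q, N.a q * N.c₁ q / N.c₀ q - N.a₂ q;
    -(N.c₂ q / N.c₀ q), -(N.c₁ q / N.c₀ q)]

theorem sum_reduced (X : Fin 2 → ℝ × ℝ → ℝ) (q : ℝ × ℝ) :
    (∑ k, N.reducedFst q 0 k * X k q = -N.vFst (X 1) (N.reducedS (X 0) (X 1)) q ∧
      ∑ k, N.reducedSnd q 0 k * X k q = -N.vFst (X 1) (N.reducedS (X 0) (X 1)) q) ∧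
    (∑ k, N.reducedFst q 1 k * X k q = N.vFst (X 1) (N.reducedS (X 0) (X 1)) q ∧
      ∑ k, N.reducedSnd q 1 k * X k q = N.reducedS (X 0) (X 1) q) := by
  refine ⟨⟨?_, ?_⟩, ?_, ?_⟩ <;>
  · simp [Fin.sum_univ_two, reducedFst, reducedSnd, vFst, reducedS]
    ring

/-- With `s` eliminated through the obstruction, vanishing of the minors makes `s` satisfy the
prolonged equations, and by `compat_iff` these are the integrability conditions of the system for
`(u, v)`. -/
theorem exists_reduced (hD : SimplyConnectedSpace W.domain)
    (hc : ∀ q ∈ W.domain, N.c₀ q ≠ 0)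
    (hG : ∀ p ∈ W.domain, N.G₁₁ p = 0 ∧ N.G₁₂ p = 0 ∧ N.G₂₁ p = 0 ∧ N.G₂₂ p = 0) {p₀ : ℝ × ℝ}
    (hp₀ : p₀ ∈ W.domain) (x y : ℝ) :
    ∃ u v s : ℝ × ℝ → ℝ, ContDiffOn ℝ ∞ u W.domain ∧ ContDiffOn ℝ ∞ v W.domain ∧
      (u p₀ = x ∧ v p₀ = y) ∧ ∀ q ∈ W.domain, N.AbelianAt u v s q := by
  have h0 := N.contDiffOn_a
  have h2 := N.contDiffOn_a₂
  have hc1 := N.contDiffOn_c₁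
  have hc2 := N.contDiffOn_c₂
  have hd : ContDiffOn ℝ ∞ (fun q => (N.c₀ q)⁻¹) W.domain := N.contDiffOn_c₀.inv hc
  have hB1 : ∀ j k : Fin 2, ContDiffOn ℝ ∞ (fun q => N.reducedFst q j k) W.domain := fun j k => by
    fin_cases j <;> fin_cases k <;> simp [reducedFst, div_eq_mul_inv] <;> fun_prop
  have hB2 : ∀ j k : Fin 2, ContDiffOn ℝ ∞ (fun q => N.reducedSnd q j k) W.domain := fun j k => by
    fin_cases j <;> fin_cases k <;> simp [reducedSnd, div_eq_mul_inv] <;> fun_prop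
  have hA : ∀ (X : Fin 2 → ℝ × ℝ → ℝ) (p : ℝ × ℝ),
      N.SystemAt ![1, 1] N.reducedFst N.reducedSnd X p →
        N.AbelianAt (X 0) (X 1) (N.reducedS (X 0) (X 1)) p := by
    intro X p h
    obtain ⟨⟨e1, e2⟩, e3, e4⟩ := N.sum_reduced X p
    have k0 := h 0
    have k1 := h 1
    rw [e1, e2] at k0
    rw [e3, e4] at k1
    exact ⟨k0, k1⟩
  have ex := N.exists_systemAt (w := ![1, 1]) hD hB1 hB2 ?_ hp₀ ![x, y]
  · obtain ⟨X, hX, hX0, hXs⟩ := ex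
    exact ⟨X 0, X 1, _, hX 0, hX 1, ⟨hX0 0, hX0 1⟩, fun q hq => hA X q (hXs q hq)⟩
  intro p hp X hX hS
  have hs : ContDiffOn ℝ ∞ (N.reducedS (X 0) (X 1)) W.domain :=
    ((hc1.mul (hX 1)).add (hc2.mul (hX 0))).neg.div N.contDiffOn_c₀ hc
  have hP := hA X p hS
  have js := Jet.of_contDiffOn (N := N) 2 hs hp
  have hob : ∀ q ∈ W.domain, N.c₀ q * N.reducedS (X 0) (X 1) q + N.c₁ q * X 1 q
      + N.c₂ q * X 0 q = 0 := fun q hq => by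
    rw [reducedS, mul_div_cancel₀ _ (hc q hq)]
    ring
  obtain ⟨d1, d2⟩ := hP.derivative_obstruction hp js hob
  obtain ⟨⟨m1, m2⟩, m3, m4⟩ := (G_eq_zero_iff hp).mp (hG p hp)
  have c0 := hc p hp
  have o := hob p hp
  -- Eliminating `s` from the differentiated obstruction by means of the obstruction itself leaves
  -- the minors as coefficients of `v` and `u`.
  have σ1 : N.δ₁ 2 (N.reducedS (X 0) (X 1)) p = N.sFst (X 0) (X 1) (N.reducedS (X 0) (X 1)) p := by
    apply mul_left_cancel₀ (mul_ne_zero c0 c0)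
    linear_combination N.c₀ p * d1 - N.dS₁ p * o - X 1 p * m1 - X 0 p * m3
  have σ2 : N.δ₂ 2 (N.reducedS (X 0) (X 1)) p = N.sSnd (X 0) (X 1) (N.reducedS (X 0) (X 1)) p := by
    apply mul_left_cancel₀ (mul_ne_zero c0 c0)
    linear_combination N.c₀ p * d2 - N.dS₂ p * o - X 1 p * m2 - X 0 p * m4
  obtain ⟨k1, k2⟩ := (compat_iff hp hP js).mpr ⟨σ1, σ2⟩
  rw [Fin.forall_fin_succ, Fin.forall_fin_succ]
  simp only [Fin.succ_zero_eq_one, N.sum_reduced X]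
  refine ⟨?_, ?_, fun i => i.elim0⟩
  · simpa using k1
  · simpa using k2

end Normalization

/-- The proportionality factors are given only pointwise. Wedging with a transversal form of the web
expresses them as smooth quotients. -/
theorem PlanarWeb.exists_scaling {d : ℕ} (W : PlanarWeb d) {i j : Fin d} (hij : i ≠ j)
    {α : OneForm} (hα : ContDiffOn ℝ ∞ α W.domain)
    (hs : ∀ p ∈ W.domain, ∃ s : ℝ, s ≠ 0 ∧ α p = s • W.form i p) :
    ∃ τ : ℝ × ℝ → ℝ, ContDiffOn ℝ ∞ τ W.domain ∧
      ∀ p ∈ W.domain, τ p ≠ 0 ∧ W.form i p = τ p • α p := by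
  have hne : ∀ p ∈ W.domain, wedge α (W.form j) p ≠ 0 := fun p hp =>
    W.wedge_ne_zero_of_scale hij hp (hs p hp) ⟨1, one_ne_zero, (one_smul ℝ _).symm⟩
  refine ⟨fun p => wedge (W.form i) (W.form j) p / wedge α (W.form j) p,
    (contDiffOn_wedge (W.smooth i) (W.smooth j)).div (contDiffOn_wedge hα (W.smooth j)) hne,
    fun p hp => ⟨div_ne_zero (W.transversal i j hij p hp) (hne p hp), ?_⟩⟩
  obtain ⟨s, hs0, h⟩ := hs p hp
  have hw : wedge α (W.form j) p = s * wedge (W.form i) (W.form j) p := by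
    simp only [wedge, h, smul_apply, smul_eq_mul]
    ring
  have := W.transversal i j hij p hp
  simp only [hw, h, smul_smul]
  field_simp
  simp

/-! ### The abelian equation in terms of `u` and `v`. -/

namespace Normalization

variable {W : PlanarWeb 4} (N : Normalization W) {p : ℝ × ℝ}

/-- The forms of a normalization, indexed as those of the web. -/
def webForm : Fin 4 → OneForm := ![N.ω₁, N.ω₂, N.ω₃, N.ω₄]

theorem exists_scalings : ∃ τ : Fin 4 → ℝ × ℝ → ℝ, (∀ i, ContDiffOn ℝ ∞ (τ i) W.domain) ∧
    ∀ i, ∀ p ∈ W.domain, τ i p ≠ 0 ∧ W.form i p = τ i p • N.webForm i p := by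
  have h : ∀ i : Fin 4, ∃ τ : ℝ × ℝ → ℝ, ContDiffOn ℝ ∞ τ W.domain ∧
      ∀ p ∈ W.domain, τ p ≠ 0 ∧ W.form i p = τ p • N.webForm i p := by
    intro i
    fin_cases i
    · exact W.exists_scaling (j := 1) (by decide) N.smooth₁ N.scale₁
    · exact W.exists_scaling (j := 0) (by decide) N.smooth₂ N.scale₂
    · exact W.exists_scaling (j := 0) (by decide) N.smooth₃ N.scale₃
    · exact W.exists_scaling (j := 0) (by decide) N.smooth₄ N.scale₄
  choose τ h1 h2 using h
  exact ⟨τ, h1, h2⟩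

variable {u v s : ℝ × ℝ → ℝ}

theorem sum_smul_webForm_eq_zero_iff (hp : p ∈ W.domain) (m : Fin 4 → ℝ) :
    ∑ i, m i • N.webForm i p = 0 ↔ m 0 = m 2 + N.a p * m 3 ∧ m 1 = m 2 + m 3 := by
  have e : ∑ i, m i • N.webForm i p =
      (m 0 - m 2 - N.a p * m 3) • N.ω₁ p + (m 1 - m 2 - m 3) • N.ω₂ p := by
    simp only [Fin.sum_univ_four, webForm, Matrix.cons_val, N.ω₃_eq hp, N.ω₄_eq hp]
    module
  rw [e]
  constructor
  · intro h
    obtain ⟨h1, h2, h3, h4⟩ := N.dual_frame hp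
    have k1 := congrArg (fun α => α (N.frame₁ p)) h
    have k2 := congrArg (fun α => α (N.frame₂ p)) h
    simp [h1, h2] at k1
    simp [h3, h4] at k2
    exact ⟨by linarith, by linarith⟩
  · rintro ⟨h1, h2⟩
    rw [h1, h2]
    module

theorem extD_smul_ω (hp : p ∈ W.domain) {f : ℝ × ℝ → ℝ} (hf : DifferentiableAt ℝ f p) :
    (extD (fun q => f q • N.ω₁ q) p = -N.δ₂ 1 f p * wedge N.ω₁ N.ω₂ p ∧
      extD (fun q => f q • N.ω₂ q) p = N.δ₁ 1 f p * wedge N.ω₁ N.ω₂ p) ∧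
    extD (fun q => f q • N.ω₃ q) p = (N.δ₂ 1 f p - N.δ₁ 1 f p) * wedge N.ω₁ N.ω₂ p ∧
      extD (fun q => f q • N.ω₄ q) p =
        (N.δ₂ 1 (fun q => N.a q * f q) p - N.δ₁ 1 f p) * wedge N.ω₁ N.ω₂ p := by
  have j : N.Jet 1 f p _ _ _ := ⟨hf, rfl, rfl, rfl⟩
  have jn := j.neg
  have ja := ((N.jet_a hp).mul j)
  have z : N.Jet 1 (fun _ => 0) p 0 0 0 :=
    ⟨differentiableAt_const _, rfl, by simp [δ₁], by simp [δ₂]⟩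
  have hD := W.domain.isOpen.mem_nhds hp
  refine ⟨⟨?_, ?_⟩, ?_, ?_⟩
  · have := N.extD_combination hp hf z.diff
    rw [z.fst, zero_sub] at this
    simpa using this
  · have := N.extD_combination hp z.diff hf
    rw [z.snd, sub_zero] at this
    simpa using this
  · have := N.extD_combination hp jn.diff jn.diff
    rw [jn.fst, jn.snd] at this
    have hev : (fun q => f q • N.ω₃ q) =ᶠ[𝓝 p] fun q => -f q • N.ω₁ q + -f q • N.ω₂ q := by
      filter_upwards [hD] with q hq
      rw [N.ω₃_eq hq]
      module
    rw [extD_congr hev, this]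
    ring
  · have := N.extD_combination hp ja.neg.diff jn.diff
    rw [jn.fst, ja.neg.snd] at this
    have hev : (fun q => f q • N.ω₄ q) =ᶠ[𝓝 p]
        fun q => -(N.a q * f q) • N.ω₁ q + -f q • N.ω₂ q := by
      filter_upwards [hD] with q hq
      rw [N.ω₄_eq hq]
      module
    rw [extD_congr hev, this, ja.snd]
    ring

/-- Closedness of the four forms of an abelian relation, in terms of `u` and `v`. -/
theorem closed_iff (hp : p ∈ W.domain) {m : Fin 4 → ℝ × ℝ → ℝ}
    (hu : ContDiffOn ℝ ∞ (m 2) W.domain) (hv : ContDiffOn ℝ ∞ (m 3) W.domain)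
    (h0 : ∀ q ∈ W.domain, m 0 q = m 2 q + N.a q * m 3 q)
    (h1 : ∀ q ∈ W.domain, m 1 q = m 2 q + m 3 q) (hs : s p = N.δ₂ 1 (m 3) p) :
    (∀ i, extD (fun q => m i q • N.webForm i q) p = 0) ↔ N.AbelianAt (m 2) (m 3) s p := by
  have hD := W.domain.isOpen.mem_nhds hp
  have ju := Jet.of_contDiffOn (N := N) 1 hu hp
  have jv := Jet.of_contDiffOn (N := N) 1 hv hp
  have jav := (N.jet_a hp).mul jv
  have j0 : N.Jet 1 (m 0) p _ _ _ := (ju.add jav).congr (g := m 0) <| by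
    filter_upwards [hD] with q hq using h0 q hq
  have j1 : N.Jet 1 (m 1) p _ _ _ := (ju.add jv).congr (g := m 1) <| by
    filter_upwards [hD] with q hq using h1 q hq
  have hw := N.wedge_ne_zero hp
  have e0 := (N.extD_smul_ω hp j0.diff).1.1
  have e1 := (N.extD_smul_ω hp j1.diff).1.2
  have e2 := (N.extD_smul_ω hp ju.diff).2.1
  have e3 := (N.extD_smul_ω hp jv.diff).2.2
  rw [j0.snd] at e0
  rw [j1.fst] at e1
  rw [jav.snd] at e3
  simp only [Fin.forall_fin_succ]
  constructor
  · rintro ⟨k0, k1, k2, k3, -⟩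
    have l0 := (mul_eq_zero.mp (e0.symm.trans k0)).resolve_right hw
    have l1 := (mul_eq_zero.mp (e1.symm.trans k1)).resolve_right hw
    have l3 := (mul_eq_zero.mp (e3.symm.trans k3)).resolve_right hw
    refine ⟨⟨ju.diff, rfl, ?_, ?_⟩, ⟨jv.diff, rfl, ?_, hs.symm⟩⟩ <;>
    · rw [vFst, hs]
      linarith
  · rintro ⟨k1, k2⟩
    have l1 := k1.fst
    have l2 := k1.snd
    have l3 := k2.fst
    rw [vFst, hs] at l1 l2 l3
    refine ⟨e0.trans ?_, e1.trans ?_, e2.trans ?_, e3.trans ?_, fun i => i.elim0⟩ <;>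
    · rw [mul_eq_zero]
      left
      linarith

/-- The equations now hold on the whole domain and may be differentiated: the commutator on `u` and
`v` gives the derivatives of `s`, and the commutator on `s` gives the obstruction. -/
theorem AbelianAt.prolonged (hv : ContDiffOn ℝ ∞ v W.domain)
    (h : ∀ q ∈ W.domain, N.AbelianAt u v (N.δ₂ 1 v) q)
    (hu : ContDiffOn ℝ ∞ u W.domain) :
    (∀ q ∈ W.domain, N.ProlongedAt u v (N.δ₂ 1 v) q) ∧
    ∀ q ∈ W.domain, N.c₀ q * N.δ₂ 1 v q + N.c₁ q * v q + N.c₂ q * u q = 0 := by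
  have hs := N.contDiffOn_δ₂ 1 hv
  have hP : ∀ q ∈ W.domain, N.ProlongedAt u v (N.δ₂ 1 v) q := by
    intro p hp
    have hD := W.domain.isOpen.mem_nhds hp
    have js := Jet.of_contDiffOn (N := N) 2 hs hp
    have cu := N.δ_comm 1 hu hp
    have cv := N.δ_comm 1 hv hp
    have e1 : N.δ₁ 2 (N.δ₂ 1 u) p = N.δ₁ 2 (fun q => -N.vFst v (N.δ₂ 1 v) q) p :=
      N.δ₁_congr <| by filter_upwards [hD] with q hq using (h q hq).jet_u.snd
    have e2 : N.δ₂ 2 (N.δ₁ 1 u) p = N.δ₂ 2 (fun q => -N.vFst v (N.δ₂ 1 v) q) p :=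
      N.δ₂_congr <| by filter_upwards [hD] with q hq using (h q hq).jet_u.fst
    have e3 : N.δ₂ 2 (N.δ₁ 1 v) p = N.δ₂ 2 (N.vFst v (N.δ₂ 1 v)) p :=
      N.δ₂_congr <| by filter_upwards [hD] with q hq using (h q hq).jet_v.fst
    norm_num at cu cv
    rw [e1, e2] at cu
    rw [e3] at cv
    obtain ⟨k1, k2⟩ := (compat_iff hp (h p hp) js).mp
      ⟨by linear_combination cu, by linear_combination cv⟩
    exact ⟨h p hp, ⟨js.diff, rfl, k1, k2⟩⟩
  refine ⟨hP, fun p hp => ?_⟩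
  have hD := W.domain.isOpen.mem_nhds hp
  have cs := N.δ_comm 2 hs hp
  have e1 : N.δ₁ 3 (N.δ₂ 2 (N.δ₂ 1 v)) p = N.δ₁ 3 (N.sSnd u v (N.δ₂ 1 v)) p :=
    N.δ₁_congr <| by filter_upwards [hD] with q hq using (hP q hq).jet_s.snd
  have e2 : N.δ₂ 3 (N.δ₁ 2 (N.δ₂ 1 v)) p = N.δ₂ 3 (N.sFst u v (N.δ₂ 1 v)) p :=
    N.δ₂_congr <| by filter_upwards [hD] with q hq using (hP q hq).jet_s.fst
  have cc := (hP p hp).compat hp hu hv hs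
  norm_num at cs
  rw [e1, e2] at cs
  linear_combination (1 / 4 : ℝ) * cs - (1 / 4 : ℝ) * cc

end Normalization

namespace Normalization

variable {W : PlanarWeb 4} (N : Normalization W) {p : ℝ × ℝ} {u v s : ℝ × ℝ → ℝ}

/-! ### Abelian relations and the rank -/

/-- The solutions of the abelian equation correspond to the pairs `(u, v)` that satisfy
`AbelianAt` on the domain. -/
theorem exists_abelian_correspondence : ∃ τ₂ τ₃ : ℝ × ℝ → ℝ,
    (∀ q ∈ W.domain, τ₂ q ≠ 0 ∧ τ₃ q ≠ 0) ∧
    (∀ l ∈ W.abelianSolutions, ∃ u v : ℝ × ℝ → ℝ, (∀ q, u q = l q 2 * τ₂ q ∧ v q = l q 3 * τ₃ q) ∧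
      ContDiffOn ℝ ∞ u W.domain ∧ ContDiffOn ℝ ∞ v W.domain ∧
      (∀ q ∈ W.domain, N.AbelianAt u v (N.δ₂ 1 v) q) ∧
      ((∀ q ∈ W.domain, u q = 0 ∧ v q = 0) → l = 0)) ∧
    ∀ u v s : ℝ × ℝ → ℝ, ContDiffOn ℝ ∞ u W.domain → ContDiffOn ℝ ∞ v W.domain →
      (∀ q ∈ W.domain, N.AbelianAt u v s q) →
      ∃ l ∈ W.abelianSolutions, ∀ q ∈ W.domain, l q 2 * τ₂ q = u q ∧ l q 3 * τ₃ q = v q := by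
  obtain ⟨τ, hτ, hτ'⟩ := N.exists_scalings
  refine ⟨τ 2, τ 3, fun q hq => ⟨(hτ' 2 q hq).1, (hτ' 3 q hq).1⟩, ?_, ?_⟩
  · rintro l ⟨l1, l2, l3, l4⟩
    let m : Fin 4 → ℝ × ℝ → ℝ := fun i q => l q i * τ i q
    have hm : ∀ i, ContDiffOn ℝ ∞ (m i) W.domain := fun i => (l1 i).mul (hτ i)
    have hform : ∀ i, ∀ q ∈ W.domain, l q i • W.form i q = m i q • N.webForm i q :=
      fun i q hq => by rw [(hτ' i q hq).2, smul_smul]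
    have hrel : ∀ q ∈ W.domain, m 0 q = m 2 q + N.a q * m 3 q ∧ m 1 q = m 2 q + m 3 q :=
      fun q hq => (N.sum_smul_webForm_eq_zero_iff hq (fun i => m i q)).mp <| by
        rw [← l3 q hq]
        exact Finset.sum_congr rfl fun i _ => (hform i q hq).symm
    refine ⟨m 2, m 3, fun q => ⟨rfl, rfl⟩, hm 2, hm 3, fun q hq => ?_, fun h0 => ?_⟩
    · refine (N.closed_iff hq (hm 2) (hm 3) (fun q hq => (hrel q hq).1)
        (fun q hq => (hrel q hq).2) rfl).mp fun i => ?_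
      rw [← l4 i q hq]
      refine extD_congr ?_
      filter_upwards [W.domain.isOpen.mem_nhds hq] with x hx using (hform i x hx).symm
    · funext q
      by_cases hq : q ∈ W.domain
      · obtain ⟨h2, h3⟩ := h0 q hq
        obtain ⟨h4, h5⟩ := hrel q hq
        rw [h2, h3, mul_zero, add_zero] at h4
        rw [h2, h3, add_zero] at h5
        have hall : ∀ i, m i q = 0 := by
          simp only [Fin.forall_fin_succ]
          exact ⟨h4, h5, h2, h3, fun i => i.elim0⟩
        funext i
        exact (mul_eq_zero.mp (hall i)).resolve_right (hτ' i q hq).1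
      · exact l2 q hq
  · intro u v s hu hv h
    let m : Fin 4 → ℝ × ℝ → ℝ := ![fun q => u q + N.a q * v q, fun q => u q + v q, u, v]
    have hm : ∀ i, ContDiffOn ℝ ∞ (m i) W.domain := by
      simp only [Fin.forall_fin_succ]
      exact ⟨hu.add (N.contDiffOn_a.mul hv), hu.add hv, hu, hv, fun i => i.elim0⟩
    classical
    let l : ℝ × ℝ → Fin 4 → ℝ := fun q i => if q ∈ W.domain then m i q / τ i q else 0
    have hl : ∀ i, ∀ q ∈ W.domain, l q i = m i q / τ i q := fun i q hq => if_pos hq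
    have hlm : ∀ i, ∀ q ∈ W.domain, l q i * τ i q = m i q := fun i q hq => by
      rw [hl i q hq, div_mul_cancel₀ _ (hτ' i q hq).1]
    have hform : ∀ i, ∀ q ∈ W.domain, l q i • W.form i q = m i q • N.webForm i q :=
      fun i q hq => by rw [(hτ' i q hq).2, smul_smul, hlm i q hq]
    refine ⟨l, ⟨fun i => ?_, fun q hq => ?_, fun q hq => ?_, fun i q hq => ?_⟩,
      fun q hq => ⟨hlm 2 q hq, hlm 3 q hq⟩⟩
    · exact ((hm i).div (hτ i) fun q hq => (hτ' i q hq).1).congr fun q hq => hl i q hq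
    · funext i
      exact if_neg hq
    · rw [Finset.sum_congr rfl fun i _ => hform i q hq]
      exact (N.sum_smul_webForm_eq_zero_iff hq (fun i => m i q)).mpr ⟨rfl, rfl⟩
    · have hc := (N.closed_iff (m := m) (s := s) hq hu hv (fun q _ => rfl) (fun q _ => rfl)
        (h q hq).jet_v.snd.symm).mpr (h q hq) i
      rw [← hc]
      refine extD_congr ?_
      filter_upwards [W.domain.isOpen.mem_nhds hq] with x hx using hform i x hx

/-- The linear form `l ↦ l p i` on the solution space of the abelian equation. -/
def _root_.PlanarWebs.PlanarWeb.evalAt {d : ℕ} (W : PlanarWeb d) (p : ℝ × ℝ) (i : Fin d) :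
    W.abelianSolutions →ₗ[ℝ] ℝ :=
  ((LinearMap.proj i).comp (LinearMap.proj p)).comp W.abelianSolutions.subtype

theorem rank_ne_two_of_injective {d : ℕ} {W : PlanarWeb d} {p : ℝ × ℝ} {i : Fin d}
    (h : Function.Injective (W.evalAt p i)) : W.rank ≠ 2 := by
  intro h2
  have := LinearMap.rank_le_of_injective _ h
  rw [Module.rank_self] at this
  have h3 : (2 : Cardinal) ≤ 1 := h2 ▸ this
  norm_num at h3

/-- The values of `(u, v, s)` at `p` are annihilated by the obstruction and its two derivatives. A
nonzero minor would leave at most one free parameter, hence rank at most one. -/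
theorem minors_eq_zero_of_rank_eq_two (hD : SimplyConnectedSpace W.domain) (h : W.rank = 2)
    (hp : p ∈ W.domain) :
    (N.c₀ p * N.dV₁ p - N.c₁ p * N.dS₁ p = 0 ∧ N.c₀ p * N.dV₂ p - N.c₁ p * N.dS₂ p = 0) ∧
      (N.c₀ p * N.dU₁ p - N.c₂ p * N.dS₁ p = 0 ∧ N.c₀ p * N.dU₂ p - N.c₂ p * N.dS₂ p = 0) := by
  obtain ⟨τ₂, τ₃, hτ, H, -⟩ := N.exists_abelian_correspondence
  have key : ∀ i : Fin 4, (∀ l ∈ W.abelianSolutions, l p i = 0 → ∀ u v : ℝ × ℝ → ℝ,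
      (u p = l p 2 * τ₂ p ∧ v p = l p 3 * τ₃ p) →
      (N.c₀ p * N.δ₂ 1 v p + N.c₁ p * v p + N.c₂ p * u p = 0) →
      (N.dS₁ p * N.δ₂ 1 v p + N.dV₁ p * v p + N.dU₁ p * u p = 0) →
      (N.dS₂ p * N.δ₂ 1 v p + N.dV₂ p * v p + N.dU₂ p * u p = 0) →
      u p = 0 ∧ v p = 0 ∧ N.δ₂ 1 v p = 0) → False := by
    intro i hi
    refine rank_ne_two_of_injective (p := p) (i := i) ?_ h
    rw [← LinearMap.ker_eq_bot, LinearMap.ker_eq_bot']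
    rintro ⟨l, hl⟩ hl0
    obtain ⟨u, v, huv, hu, hv, hA, h0⟩ := H l hl
    obtain ⟨hP, hc⟩ := AbelianAt.prolonged N hv hA hu
    obtain ⟨d1, d2⟩ := (hA p hp).derivative_obstruction hp (hP p hp).jet_s hc
    rw [sub_self, mul_zero] at d1 d2
    obtain ⟨hu0, hv0, hs0⟩ := hi l hl hl0 u v (huv p) (hc p hp) d1 d2
    exact Subtype.ext (h0 (ProlongedAt.eq_zero N hD hP hp hu0 hv0 hs0))
  -- A row `(dS, dV, dU)` stands for either derivative of the obstruction. If the minor in `s, v` is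
  -- nonzero, Cramer's rule makes `u p = 0` force everything to vanish, so evaluation of component 2
  -- is injective; the minor in `s, u` is treated with component 3.
  have kV : ∀ dS dV dU : ℝ, (∀ x y z : ℝ, N.c₀ p * z + N.c₁ p * y + N.c₂ p * x = 0 →
      N.dS₁ p * z + N.dV₁ p * y + N.dU₁ p * x = 0 →
      N.dS₂ p * z + N.dV₂ p * y + N.dU₂ p * x = 0 → dS * z + dV * y + dU * x = 0) →
      N.c₀ p * dV - N.c₁ p * dS = 0 ∧ N.c₀ p * dU - N.c₂ p * dS = 0 := by
    intro dS dV dU hd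
    constructor
    · by_contra hne
      refine key 2 fun l _ hl0 u v ⟨hu, _⟩ e e1 e2 => ?_
      rw [hl0, zero_mul] at hu
      have e3 := hd _ _ _ e e1 e2
      rw [hu, mul_zero, add_zero] at e e3
      refine ⟨hu, ?_, ?_⟩ <;> apply mul_left_cancel₀ hne
      · linear_combination N.c₀ p * e3 - dS * e
      · linear_combination dV * e - N.c₁ p * e3
    · by_contra hne
      refine key 3 fun l _ hl0 u v ⟨_, hv⟩ e e1 e2 => ?_
      rw [hl0, zero_mul] at hv
      have e3 := hd _ _ _ e e1 e2
      rw [hv, mul_zero, add_zero] at e e3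
      refine ⟨?_, hv, ?_⟩ <;> apply mul_left_cancel₀ hne
      · linear_combination N.c₀ p * e3 - dS * e
      · linear_combination dU * e - N.c₂ p * e3
  obtain ⟨a1, b1⟩ := kV _ _ _ fun x y z _ h _ => h
  obtain ⟨a2, b2⟩ := kV _ _ _ fun x y z _ _ h => h
  exact ⟨⟨a1, a2⟩, b1, b2⟩

/-- For `c₀ = 0` the minors reduce to `c₁` and `c₂` times `a (c₁ - c₂)` and `c₁ - a c₂`. Eliminating
`c₁ c₂` leaves `(1 - a) c₁² = (1 - a) c₂² = 0`. -/
theorem c_eq_zero_of_c₀_eq_zero (hD : SimplyConnectedSpace W.domain) (h : W.rank = 2)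
    (hc : ∀ q ∈ W.domain, N.c₀ q = 0) (hp : p ∈ W.domain) : N.c₁ p = 0 ∧ N.c₂ p = 0 := by
  obtain ⟨⟨m1, m2⟩, m3, m4⟩ := N.minors_eq_zero_of_rank_eq_two hD h hp
  have n0 := N.a_ne_zero hp
  have n1 := N.one_sub_a_ne_zero hp
  have z : N.Jet 2 (fun _ => 0) p 0 0 0 :=
    ⟨differentiableAt_const _, rfl, by simp [δ₁], by simp [δ₂]⟩
  obtain ⟨-, z1, z2⟩ := (Jet.of_contDiffOn (N := N) 2 N.contDiffOn_c₀ hp).eq z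
    (by filter_upwards [W.domain.isOpen.mem_nhds hp] with q hq using hc q hq)
  have z1' : N.c₀₁ p = 0 := z1
  have z2' : N.c₀₂ p = 0 := z2
  rw [dS₁, hc p hp, z1'] at m1 m3
  rw [dS₂, hc p hp, z2'] at m2 m4
  have f1 : (1 - N.a p) * N.c₁ p * N.c₁ p = 0 := by
    apply mul_left_cancel₀ n0
    linear_combination -N.a p * m2 + N.a p * m1
  have f2 : (1 - N.a p) * N.c₂ p * N.c₂ p = 0 := by
    apply mul_left_cancel₀ n0
    linear_combination -N.a p * m4 + m3
  constructor
  · rcases mul_eq_zero.mp f1 with h | h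
    · exact (mul_eq_zero.mp h).resolve_left n1
    · exact h
  · rcases mul_eq_zero.mp f2 with h | h
    · exact (mul_eq_zero.mp h).resolve_left n1
    · exact h

theorem exists_c₀_ne_zero_of_rank_eq_two (hD : SimplyConnectedSpace W.domain) (h : W.rank = 2) :
    ∃ p ∈ W.domain, N.c₀ p ≠ 0 := by
  by_contra! hc
  obtain ⟨p, hp⟩ : (W.domain : Set (ℝ × ℝ)).Nonempty :=
    Set.nonempty_coe_sort.mp (inferInstanceAs (Nonempty W.domain))
  have hcs : ∀ q ∈ W.domain, N.c₀ q = 0 ∧ N.c₁ q = 0 ∧ N.c₂ q = 0 := fun q hq =>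
    ⟨hc q hq, N.c_eq_zero_of_c₀_eq_zero hD h hc hq⟩
  obtain ⟨τ₂, τ₃, hτ, H, H'⟩ := N.exists_abelian_correspondence
  obtain ⟨t2, t3⟩ := hτ p hp
  have hfr : Module.finrank ℝ W.abelianSolutions = 2 :=
    Module.finrank_eq_of_rank_eq (by exact_mod_cast h)
  have : FiniteDimensional ℝ W.abelianSolutions :=
    FiniteDimensional.of_finrank_pos (by rw [hfr]; norm_num)
  let φ : W.abelianSolutions →ₗ[ℝ] ℝ × ℝ := (W.evalAt p 2).prod (W.evalAt p 3)
  have hsurj : Function.Surjective φ := by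
    rintro ⟨x, y⟩
    obtain ⟨u, v, s, hu, hv, ⟨hu0, hv0, -⟩, hA⟩ :=
      N.exists_prolonged hD hcs hp (x * τ₂ p) (y * τ₃ p) 0
    obtain ⟨l, hl, hlq⟩ := H' u v s hu hv hA
    obtain ⟨k1, k2⟩ := hlq p hp
    exact ⟨⟨l, hl⟩, Prod.ext (mul_right_cancel₀ t2 (k1.trans hu0))
      (mul_right_cancel₀ t3 (k2.trans hv0))⟩
  have hinj : Function.Injective φ :=
    (LinearMap.injective_iff_surjective_of_finrank_eq_finrank (by simp [hfr])).mpr hsurj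
  -- A dimension count has made evaluation of `(u, v)` at `p` injective, but the solution with
  -- initial value `(0, 0, 1)` lies in its kernel: it would be zero although `δ₂ v = 1` at `p`.
  obtain ⟨u, v, s, hu, hv, ⟨hu0, hv0, hs0⟩, hA⟩ := N.exists_prolonged hD hcs hp 0 0 1
  obtain ⟨l, hl, hlq⟩ := H' u v s hu hv hA
  obtain ⟨k1, k2⟩ := hlq p hp
  have hl0 : (⟨l, hl⟩ : W.abelianSolutions) = 0 := hinj <| by
    rw [map_zero]
    exact Prod.ext ((mul_eq_zero.mp (k1.trans hu0)).resolve_right t2)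
      ((mul_eq_zero.mp (k2.trans hv0)).resolve_right t3)
  have hl0' : l = 0 := congrArg Subtype.val hl0
  have hvz : v =ᶠ[𝓝 p] fun _ => 0 := by
    filter_upwards [W.domain.isOpen.mem_nhds hp] with q hq
    rw [← (hlq q hq).2, hl0']
    simp
  have hs1 := (hA p hp).jet_v.snd
  rw [N.δ₂_congr hvz, hs0] at hs1
  simp [δ₂] at hs1

/-- Evaluation of `(u, v)` at a point is an isomorphism onto the plane: surjective by the reduced
system, and injective because the obstruction with `c₀ ≠ 0` then yields `s = 0`. -/
theorem rank_eq_two (hD : SimplyConnectedSpace W.domain) (hc : ∀ q ∈ W.domain, N.c₀ q ≠ 0)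
    (hG : ∀ p ∈ W.domain, N.G₁₁ p = 0 ∧ N.G₁₂ p = 0 ∧ N.G₂₁ p = 0 ∧ N.G₂₂ p = 0) :
    W.rank = 2 := by
  obtain ⟨p, hp⟩ : (W.domain : Set (ℝ × ℝ)).Nonempty :=
    Set.nonempty_coe_sort.mp (inferInstanceAs (Nonempty W.domain))
  obtain ⟨τ₂, τ₃, hτ, H, H'⟩ := N.exists_abelian_correspondence
  obtain ⟨t2, t3⟩ := hτ p hp
  let φ : W.abelianSolutions →ₗ[ℝ] ℝ × ℝ := (W.evalAt p 2).prod (W.evalAt p 3)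
  have hsurj : Function.Surjective φ := by
    rintro ⟨x, y⟩
    obtain ⟨u, v, s, hu, hv, ⟨hu0, hv0⟩, hA⟩ :=
      N.exists_reduced hD hc hG hp (x * τ₂ p) (y * τ₃ p)
    obtain ⟨l, hl, hlq⟩ := H' u v s hu hv hA
    obtain ⟨k1, k2⟩ := hlq p hp
    exact ⟨⟨l, hl⟩, Prod.ext (mul_right_cancel₀ t2 (k1.trans hu0))
      (mul_right_cancel₀ t3 (k2.trans hv0))⟩
  have hinj : Function.Injective φ := by
    rw [← LinearMap.ker_eq_bot, LinearMap.ker_eq_bot']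
    rintro ⟨l, hl⟩ hl0
    obtain ⟨u, v, huv, hu, hv, hA, h0⟩ := H l hl
    obtain ⟨hP, hob⟩ := AbelianAt.prolonged N hv hA hu
    obtain ⟨e2, e3⟩ := Prod.ext_iff.mp hl0
    have e2' : l p 2 = 0 := e2
    have e3' : l p 3 = 0 := e3
    have hu0 : u p = 0 := by rw [(huv p).1, e2', zero_mul]
    have hv0 : v p = 0 := by rw [(huv p).2, e3', zero_mul]
    have hs0 := hob p hp
    rw [hu0, hv0, mul_zero, mul_zero, add_zero, add_zero] at hs0
    exact Subtype.ext (h0 (ProlongedAt.eq_zero N hD hP hp hu0 hv0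
      ((mul_eq_zero.mp hs0).resolve_left (hc p hp))))
  have := (LinearEquiv.ofBijective φ ⟨hinj, hsurj⟩).rank_eq
  rw [PlanarWeb.rank, this, ← Module.finrank_eq_rank]
  simp

end Normalization

end PlanarWebs

end

theorem mainTheorem5 (W : PlanarWebs.PlanarWeb 4)
    (hD : SimplyConnectedSpace W.domain)
    (N : PlanarWebs.Normalization W) :
    (W.rank = 2 → (∃ p ∈ W.domain, N.c₀ p ≠ 0) ∧
      ∀ p ∈ W.domain, N.G₁₁ p = 0 ∧ N.G₁₂ p = 0 ∧ N.G₂₁ p = 0 ∧ N.G₂₂ p = 0) ∧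
    ((∀ p ∈ W.domain, N.c₀ p = 0) ∨ (∀ p ∈ W.domain, N.c₀ p ≠ 0) →
      (W.rank = 2 ↔ (∀ p ∈ W.domain, N.c₀ p ≠ 0) ∧
        ∀ p ∈ W.domain, N.G₁₁ p = 0 ∧ N.G₁₂ p = 0 ∧ N.G₂₁ p = 0 ∧ N.G₂₂ p = 0)) := by
  have h₁ : W.rank = 2 → (∃ p ∈ W.domain, N.c₀ p ≠ 0) ∧
      ∀ p ∈ W.domain, N.G₁₁ p = 0 ∧ N.G₁₂ p = 0 ∧ N.G₂₁ p = 0 ∧ N.G₂₂ p = 0 := fun h =>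
    ⟨N.exists_c₀_ne_zero_of_rank_eq_two hD h, fun p hp =>
      (PlanarWebs.Normalization.G_eq_zero_iff hp).mpr (N.minors_eq_zero_of_rank_eq_two hD h hp)⟩
  refine ⟨h₁, fun hc => ⟨fun h => ⟨hc.resolve_left fun h0 => ?_, (h₁ h).2⟩,
    fun h => N.rank_eq_two hD h.1 h.2⟩⟩
  obtain ⟨p, hp, hne⟩ := (h₁ h).1
  exact hne (h0 p hp)
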